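/- Let $k$ be a field of characteristic zero and let $B$ be an affine $k$-domain (an integral domain that is a finitely generated $k$-algebra). A pair $(D,U)$ of locally nilpotent $k$-derivations of a $k$-domain $R$ is called a fundamental pair for $R$ if $[D,[D,U]]=-2D$, $[U,[D,U]]=2U$, and $R=\sum_{d\in\mathbb{Z}}\ker([D,U]-d\,I)$. An action of $SL_2(k)$ on $R$ by $k$-algebra automorphisms is algebraic if for every $b\in R$ there are finitely many $c_i\in R$ and polynomials $P_i$ over $k$ in the four matrix entries such that $g\cdot b=\sum_i P_i(g)\,c_i$ for all $g\in SL_2(k)$. It is the action defined by $(D,U)$ if it is algebraic and, for all $s,t\in k$, the matrices $\begin{pmatrix}1&0\\ t&1\end{pmatrix}$ and $\begin{pmatrix}1&s\\ 0&1\end{pmatrix}$ act as $\exp(tD)$ and $\exp(sU)$. Let $(D,U)$ be a fundamental pair for $B$. On the polynomial ring $B[X,Y]$ extend $D$ and $U$ coefficientwise (so that they kill $X$ and $Y$), and put $D'=D+X\partial_Y$ and $U'=U+Y\partial_X$. Then: 1. $(D',U')$ is a fundamental pair for $B[X,Y]$, and there is exactly one action of $SL_2(k)$ on $B[X,Y]$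 defined by $(D',U')$; 2. the kernel $\ker D$ is isomorphic, as a $k$-algebra, to the ring of invariants $B[X,Y]^{SL_2(k)}$ of this action; 3. $\ker D$ is finitely generated as a $k$-algebra. -/

import Mathlib

open scoped MatrixGroups

noncomputable section

namespace FundPair

variable {k : Type*} [Field k] {B : Type*} [CommRing B] [Algebra k B]

/-- `D` is locally nilpotent: every element is killed by some power of `D`. -/
def IsLocallyNilpotent (D : Derivation k B B) : Prop :=
  ∀ b : B, ∃ n : ℕ, (⇑D)^[n] b = 0

/-- A fundamental pair: `D` and `U` are locally nilpotent, `[D,[D,U]] = -2D`, `[U,[D,U]] = 2U`, and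
`B` is the sum over `d ∈ ℤ` of the subspaces `B_d = ker ([D,U] - d I)`. -/
structure IsFundamentalPair (D U : Derivation k B B) : Prop where
  locallyNilpotent_left : IsLocallyNilpotent D
  locallyNilpotent_right : IsLocallyNilpotent U
  lie_left : ⁅D, ⁅D, U⁆⁆ = (-2 : k) • D
  lie_right : ⁅U, ⁅D, U⁆⁆ = (2 : k) • U
  sum_eq_top :
    ⨆ d : ℤ, LinearMap.ker ((⁅D, U⁆ : Derivation k B B).toLinearMap - (d : k) • LinearMap.id) = ⊤

/-- The kernel of a derivation, as a `k`-subalgebra. -/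
def kerAlg (D : Derivation k B B) : Subalgebra k B where
  carrier := {b | D b = 0}
  mul_mem' := by
    intro a b ha hb
    change D a = 0 at ha
    change D b = 0 at hb
    change D _ = 0
    simp [ha, hb]
  add_mem' := by
    intro a b ha hb
    change D a = 0 at ha
    change D b = 0 at hb
    change D _ = 0
    simp [ha, hb]
  algebraMap_mem' := fun r => D.map_algebraMap r

theorem mem_kerAlg (D : Derivation k B B) (b : B) : b ∈ kerAlg D ↔ D b = 0 := Iff.rfl

/-! ### The pair `(D + X ∂_Y, U + Y ∂_X)` on `B[X, Y]`, with `X = X 0` and `Y = X 1` -/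

/-- `D` applied to each coefficient of a polynomial, as a `k`-linear map. -/
def coeffLin {σ : Type*} (D : Derivation k B B) : MvPolynomial σ B →ₗ[k] MvPolynomial σ B where
  toFun := fun p => AddMonoidAlgebra.map (D : B →+ B) p
  map_add' := by
    intro p q
    ext m
    simp
  map_smul' := by
    intro r p
    ext m
    simp

theorem coeffLin_monomial {σ : Type*} (D : Derivation k B B) (m : σ →₀ ℕ) (b : B) :
    coeffLin D (MvPolynomial.monomial m b) = MvPolynomial.monomial m (D b) :=
  AddMonoidAlgebra.map_single (D : B →+ B) b m

/-- The trivial extension of `D` to a polynomial ring: `D` applied to each coefficient. -/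
def coeffDer {σ : Type*} (D : Derivation k B B) :
    Derivation k (MvPolynomial σ B) (MvPolynomial σ B) :=
  Derivation.mk' (coeffLin D) (by
    intro p q
    induction p using MvPolynomial.induction_on' with
    | add p₁ p₂ h₁ h₂ =>
      rw [add_mul, map_add, h₁, h₂, map_add]
      simp only [smul_eq_mul]
      ring
    | monomial m a =>
      induction q using MvPolynomial.induction_on' with
      | add q₁ q₂ h₁ h₂ =>
        rw [mul_add, map_add, h₁, h₂, map_add]
        simp only [smul_eq_mul]
        ring
      | monomial n b =>
        simp only [MvPolynomial.monomial_mul, coeffLin_monomial, smul_eq_mul, Derivation.leibniz,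
          map_add]
        rw [add_comm n m, mul_comm b])

theorem coeffDer_C {σ : Type*} (D : Derivation k B B) (b : B) :
    coeffDer D (MvPolynomial.C b : MvPolynomial σ B) = MvPolynomial.C (D b) :=
  coeffLin_monomial D 0 b

theorem coeffDer_X {σ : Type*} (D : Derivation k B B) (i : σ) :
    coeffDer D (MvPolynomial.X i : MvPolynomial σ B) = 0 := by
  have h := coeffLin_monomial D (Finsupp.single i 1) (1 : B)
  rw [Derivation.map_one_eq_zero, MvPolynomial.monomial_zero] at h
  exact h

/-- `D + X ∂_Y` on `B[X, Y]`. -/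
def extD (D : Derivation k B B) :
    Derivation k (MvPolynomial (Fin 2) B) (MvPolynomial (Fin 2) B) :=
  coeffDer D +
    (MvPolynomial.X 0 : MvPolynomial (Fin 2) B) •
      (MvPolynomial.pderiv (R := B) (1 : Fin 2)).restrictScalars k

/-- `U + Y ∂_X` on `B[X, Y]`. -/
def extU (U : Derivation k B B) :
    Derivation k (MvPolynomial (Fin 2) B) (MvPolynomial (Fin 2) B) :=
  coeffDer U +
    (MvPolynomial.X 1 : MvPolynomial (Fin 2) B) •
      (MvPolynomial.pderiv (R := B) (0 : Fin 2)).restrictScalars k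

/-! ### The action of `SL₂(k)` defined by a fundamental pair -/

/-- `exp(tD)(b) = ∑ i, (t ^ i / i!) D^i(b)`, a finite sum when `D` is locally nilpotent. -/
def expDer (D : Derivation k B B) (t : k) (b : B) : B :=
  ∑ᶠ i : ℕ, (t ^ i / (i.factorial : k)) • (⇑D)^[i] b

/-- The lower triangular unipotent matrix with rows `(1, 0)` and `(t, 1)`. -/
def lowerUnip (t : k) : SL(2, k) := ⟨!![1, 0; t, 1], by simp⟩

/-- The upper triangular unipotent matrix with rows `(1, s)` and `(0, 1)`. -/
def upperUnip (s : k) : SL(2, k) := ⟨!![1, s; 0, 1], by simp⟩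

/-- An action of `SL₂(k)` on `B` by `k`-algebra automorphisms is algebraic: for each `b`, the
element `g • b` is a combination of finitely many fixed elements of `B` whose coefficients are
polynomial functions of the four entries of `g`. (As `k` is infinite, `SL₂(k)` is Zariski dense
in the group scheme `SL₂`, so that this is the same as a coaction `B → B ⊗ k[SL₂]`.) -/
def IsAlgebraicAction (ρ : SL(2, k) →* (B ≃ₐ[k] B)) : Prop :=
  ∀ b : B, ∃ (n : ℕ) (P : Fin n → MvPolynomial (Fin 2 × Fin 2) k) (c : Fin n → B),
    ∀ g : SL(2, k), ρ g b = ∑ i, MvPolynomial.eval (fun x => g.1 x.1 x.2) (P i) • c i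

/-- `ρ` is the algebraic action of `SL₂(k)` on `B` defined by the pair `(D, U)`: the lower and
upper triangular one-parameter unipotent subgroups act by `exp(tD)` and `exp(sU)`. -/
structure IsActionOf (D U : Derivation k B B) (ρ : SL(2, k) →* (B ≃ₐ[k] B)) : Prop where
  algebraic : IsAlgebraicAction ρ
  lower : ∀ (t : k) (b : B), ρ (lowerUnip t) b = expDer D t b
  upper : ∀ (s : k) (b : B), ρ (upperUnip s) b = expDer U s b

/-- The `k`-algebra of invariants of an action of `SL₂(k)`. -/
def invariants (ρ : SL(2, k) →* (B ≃ₐ[k] B)) : Subalgebra k B where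
  carrier := {b | ∀ g, ρ g b = b}
  mul_mem' := fun {a b} ha hb g => by rw [map_mul, ha g, hb g]
  add_mem' := fun {a b} ha hb g => by rw [map_add, ha g, hb g]
  algebraMap_mem' := fun r g => (ρ g).commutes r

theorem mem_invariants (ρ : SL(2, k) →* (B ≃ₐ[k] B)) (b : B) :
    b ∈ invariants ρ ↔ ∀ g, ρ g b = b := Iff.rfl

end FundPair

end

open scoped MatrixGroups

noncomputable section

namespace FundPair

open MvPolynomial

/-! ### Weight spaces and highest weight vectors of a fundamental pair -/

section Weight

variable {k : Type*} [Field k] {B : Type*} [CommRing B] [Algebra k B] {D U : Derivation k B B}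

/-! With `E = [D,U]`, a fundamental pair is an `sl₂`-triple acting by derivations: `D` raises
weights by 2 and `U` lowers them by 2. Local nilpotency together with the weight decomposition
forces `B` to be spanned by finite strings `f, Uf, …, U^e f` with `Df = 0` and `f` of weight `e`
(`span_stringVectors`). Everything rests on this.

The action: each such `f` gives an intertwiner from `k[X,Y]`, supported on forms of degree `e`, and
the images of these span `B`. An endomorphism lying over a given matrix substitution is therefore
unique. It exists for unipotent matrices, by exponentials, hence for all of `SL₂(k)`, which they
generate. Invariants of the action are exactly `ker D ∩ ker U` (`invariants_eq_pairInvariants`).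

The kernel: setting `X = 0`, `Y = 1` turns `D + X∂_Y` into `D`, so it sends invariants of the
extended pair into `ker D`. Conversely a highest weight vector `f` of weight `e` is the leading
coefficient of the invariant form `∑ (-1)^i/i! U^i f X^i Y^(e-i)`. This gives
`bijective_evalInvariants`.

Finite generation is Hilbert's argument. The Casimir operator separates `ker D ∩ ker U` from `DB +
UB`, and this decomposition serves as a Reynolds operator. It handles linear pairs on polynomial
rings (`fg_pairInvariants_of_linear`) and carries invariants through equivariant surjections
(`fg_pairInvariants_of_surjective`). Any affine `B` is such a quotient, with variables indexed by
finitely many strings. Applied to the extended pair on `B[X,Y]`, this gives the result for `ker D`.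
-/

/-- The weight space `B_d = ker ([D,U] - d I)`. -/
def weightSpace (D U : Derivation k B B) (d : ℤ) : Submodule k B :=
  LinearMap.ker ((⁅D, U⁆ : Derivation k B B).toLinearMap - (d : k) • LinearMap.id)

theorem mem_weightSpace {d : ℤ} {b : B} : b ∈ weightSpace D U d ↔ ⁅D, U⁆ b = (d : k) • b := by
  rw [weightSpace, LinearMap.mem_ker, LinearMap.sub_apply, sub_eq_zero]
  rfl

theorem apply_apply_eq (D U : Derivation k B B) (b : B) : D (U b) = U (D b) + ⁅D, U⁆ b := by
  rw [Derivation.commutator_apply]; abel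

theorem weightSpace_mul_mem {d e : ℤ} {a b : B} (ha : a ∈ weightSpace D U d)
    (hb : b ∈ weightSpace D U e) : a * b ∈ weightSpace D U (d + e) := by
  rw [mem_weightSpace] at *
  rw [Derivation.leibniz, ha, hb]
  simp only [smul_eq_mul, Int.cast_add, add_smul, mul_smul_comm]
  rw [mul_comm b a, add_comm]

theorem algebraMap_mem_weightSpace (r : k) : algebraMap k B r ∈ weightSpace D U 0 := by
  simp [mem_weightSpace]

/-- The set of vectors `U^i f` with `f` a highest weight vector of weight `e` and `i ≤ e`. -/
def stringVectors (D U : Derivation k B B) : Set B :=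
  {b | ∃ (e i : ℕ) (f : B), i ≤ e ∧ D f = 0 ∧ f ∈ weightSpace D U e ∧ (⇑U)^[i] f = b}

/-- The vectors of `stringVectors` of weight `d`. -/
def stringVectorsOfWeight (D U : Derivation k B B) (d : ℤ) : Set B :=
  {b | ∃ (e i : ℕ) (f : B), i ≤ e ∧ d = e - 2 * i ∧ D f = 0 ∧ f ∈ weightSpace D U e ∧
    (⇑U)^[i] f = b}

namespace IsFundamentalPair

variable (h : IsFundamentalPair D U)
include h

theorem lie_apply_left (b : B) : ⁅D, U⁆ (D b) = D (⁅D, U⁆ b) + (2 : k) • D b := by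
  have := Derivation.congr_fun h.lie_left b
  rw [Derivation.commutator_apply, Derivation.smul_apply, neg_smul] at this
  rw [eq_neg_iff_add_eq_zero] at this
  linear_combination -this

theorem lie_apply_right (b : B) : ⁅D, U⁆ (U b) = U (⁅D, U⁆ b) - (2 : k) • U b := by
  have := Derivation.congr_fun h.lie_right b
  rw [Derivation.commutator_apply, Derivation.smul_apply] at this
  linear_combination -this

theorem left_mem {d : ℤ} {b : B} (hb : b ∈ weightSpace D U d) :
    D b ∈ weightSpace D U (d + 2) := by
  rw [mem_weightSpace] at *
  rw [h.lie_apply_left, hb, Derivation.map_smul, ← add_smul]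
  norm_num

theorem right_mem {d : ℤ} {b : B} (hb : b ∈ weightSpace D U d) :
    U b ∈ weightSpace D U (d - 2) := by
  rw [mem_weightSpace] at *
  rw [h.lie_apply_right, hb, Derivation.map_smul, ← sub_smul]
  norm_num

theorem iterate_right_mem {d : ℤ} {b : B} (hb : b ∈ weightSpace D U d) (i : ℕ) :
    (⇑U)^[i] b ∈ weightSpace D U (d - 2 * i) := by
  induction i with
  | zero => simpa using hb
  | succ i ih =>
    rw [Function.iterate_succ_apply']
    convert h.right_mem ih using 2
    push_cast
    ring

/-- Moving `D` past the copies of `U` collects the weights `d, d-2, …, d-2i`, whose sum is the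
coefficient. Assuming `U(Df) = 0` instead of `Df = 0` matters: the formula is needed for vectors not
yet known to be killed by `D`. -/
theorem left_iterate_right {d : ℤ} {f : B} (hf : f ∈ weightSpace D U d) (hUD : U (D f) = 0)
    (i : ℕ) : D ((⇑U)^[i + 1] f) = (((i : k) + 1) * (d - i)) • (⇑U)^[i] f := by
  induction i with
  | zero =>
    rw [mem_weightSpace] at hf
    simp [apply_apply_eq, hUD, hf]
  | succ i ih =>
    have hw := h.iterate_right_mem hf (i + 1)
    rw [mem_weightSpace] at hw
    rw [Function.iterate_succ_apply', apply_apply_eq, hw, ih, Derivation.map_smul,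
      ← Function.iterate_succ_apply' (⇑U), ← add_smul]
    push_cast
    congr 1
    ring

theorem span_stringVectorsOfWeight_le (d : ℤ) :
    Submodule.span k (stringVectorsOfWeight D U d) ≤ weightSpace D U d := by
  rw [Submodule.span_le]
  rintro _ ⟨e, i, f, -, rfl, -, hf, rfl⟩
  exact h.iterate_right_mem hf i

variable [CharZero k]

/-- If `U^m f` is the last nonzero iterate, applying `D` to `U^(m+1) f = 0` gives `(m+1)(d-m) = 0`.
-/
theorem exists_weight_eq_natCast {d : ℤ} {f : B} (hf : f ∈ weightSpace D U d)
    (hUD : U (D f) = 0) (h0 : f ≠ 0) : ∃ m : ℕ, d = m ∧ (⇑U)^[m + 1] f = 0 := by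
  classical
  have hex := h.locallyNilpotent_right f
  obtain ⟨m, hm⟩ : ∃ m, Nat.find hex = m + 1 := by
    refine Nat.exists_eq_succ_of_ne_zero fun h1 => h0 ?_
    simpa [h1] using Nat.find_spec hex
  have h1 : (⇑U)^[m + 1] f = 0 := hm ▸ Nat.find_spec hex
  have h2 : (⇑U)^[m] f ≠ 0 := Nat.find_min hex (by omega)
  have h3 := h.left_iterate_right hf hUD m
  rw [h1, map_zero, eq_comm, smul_eq_zero, or_iff_left h2, mul_eq_zero,
    or_iff_right (Nat.cast_add_one_ne_zero m), sub_eq_zero] at h3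
  exact ⟨m, by exact_mod_cast h3, h1⟩

theorem iterate_right_eq_zero {e : ℕ} {f : B} (hf : f ∈ weightSpace D U e) (hD : D f = 0) :
    (⇑U)^[e + 1] f = 0 := by
  by_cases h0 : f = 0
  · subst h0; exact iterate_map_zero U _
  · obtain ⟨m, hm, hU⟩ := h.exists_weight_eq_natCast hf (by rw [hD, map_zero]) h0
    rwa [show e = m by exact_mod_cast hm]

/-- Within a string, `D` reaches every vector except the bottom one `U^e f`. That one is killed by
`U` and has weight `-e ≤ 0`, so it can only occur when `d + 2 ≤ 0`. -/
theorem exists_eq_left_add {d : ℤ} {c : B}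
    (hc : c ∈ Submodule.span k (stringVectorsOfWeight D U (d + 2))) :
    ∃ s ∈ Submodule.span k (stringVectorsOfWeight D U d), ∃ v, c = D s + v ∧ U v = 0 ∧
      (0 ≤ d → v = 0) := by
  induction hc using Submodule.span_induction with
  | mem x hx =>
    obtain ⟨e, i, f, hi, hd, hD, hf, rfl⟩ := hx
    rcases hi.lt_or_eq with hi | rfl
    · have hne : ((i : k) + 1) * ((e : ℤ) - i) ≠ 0 :=
        mul_ne_zero (Nat.cast_add_one_ne_zero i)
          (sub_ne_zero.2 (by exact_mod_cast hi.ne'))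
      refine ⟨(((i : k) + 1) * ((e : ℤ) - i))⁻¹ • (⇑U)^[i + 1] f,
        Submodule.smul_mem _ _ (Submodule.subset_span
          ⟨e, i + 1, f, hi, by push_cast; linarith, hD, hf, rfl⟩), 0, ?_, map_zero _,
        fun _ => rfl⟩
      rw [Derivation.map_smul, h.left_iterate_right hf (by rw [hD, map_zero]), smul_smul,
        inv_mul_cancel₀ hne, one_smul, add_zero]
    · refine ⟨0, zero_mem _, (⇑U)^[i] f, by simp, ?_, fun h0 => by omega⟩
      rw [← Function.iterate_succ_apply' (⇑U)]
      exact h.iterate_right_eq_zero hf hD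
  | zero => exact ⟨0, zero_mem _, 0, by simp, map_zero _, fun _ => rfl⟩
  | add x y _ _ hx hy =>
    obtain ⟨s, hs, v, rfl, hv, hv'⟩ := hx
    obtain ⟨t, ht, w, rfl, hw, hw'⟩ := hy
    refine ⟨s + t, add_mem hs ht, v + w, by rw [map_add]; abel, by rw [map_add, hv, hw, add_zero],
      fun h0 => by rw [hv' h0, hw' h0, add_zero]⟩
  | smul a x _ hx =>
    obtain ⟨s, hs, v, rfl, hv, hv'⟩ := hx
    refine ⟨a • s, Submodule.smul_mem _ _ hs, a • v, by rw [Derivation.map_smul, smul_add],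
      by rw [Derivation.map_smul, hv, smul_zero], fun h0 => by rw [hv' h0, smul_zero]⟩

/-- Induction on the nilpotency order: `Db` lies in the span of strings, so subtracting a suitable
`s` from `b` leaves `x` with `UDx = 0`. A nonzero such `x` has weight at least 0, which forces `Dx =
0`, so `x` is itself the top of a string. -/
theorem mem_span_stringVectorsOfWeight (n : ℕ) {d : ℤ} {b : B} (hb : b ∈ weightSpace D U d)
    (hn : (⇑D)^[n] b = 0) : b ∈ Submodule.span k (stringVectorsOfWeight D U d) := by
  induction n generalizing d b with
  | zero =>
    rw [show b = 0 from hn]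
    exact zero_mem _
  | succ n ih =>
    obtain ⟨s, hs, v, hv, hUv, hv0⟩ := h.exists_eq_left_add (ih (h.left_mem hb) hn)
    have hD : D (b - s) = v := by rw [map_sub, hv]; abel
    have hx : b - s ∈ weightSpace D U d :=
      sub_mem hb (h.span_stringVectorsOfWeight_le d hs)
    rw [← sub_add_cancel b s]
    refine add_mem ?_ hs
    by_cases h0 : b - s = 0
    · rw [h0]; exact zero_mem _
    · obtain ⟨m, rfl, -⟩ := h.exists_weight_eq_natCast hx (by rw [hD, hUv]) h0
      exact Submodule.subset_span
        ⟨m, 0, b - s, zero_le, by simp, by rw [hD, hv0 (Int.natCast_nonneg m)], hx, rfl⟩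

theorem span_stringVectors : Submodule.span k (stringVectors D U) = ⊤ := by
  refine eq_top_iff.2 (h.sum_eq_top.symm.le.trans (iSup_le fun d b hb => ?_))
  obtain ⟨n, hn⟩ := h.locallyNilpotent_left b
  refine Submodule.span_mono ?_ (h.mem_span_stringVectorsOfWeight n hb hn)
  rintro _ ⟨e, i, f, hi, -, hD, hf, rfl⟩
  exact ⟨e, i, f, hi, hD, hf, rfl⟩

end IsFundamentalPair

theorem iSupIndep_weightSpace [CharZero k] (D U : Derivation k B B) : iSupIndep (weightSpace D U) := by
  have h1 := (Module.End.eigenspaces_iSupIndep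
    (⁅D, U⁆ : Derivation k B B).toLinearMap).comp (Int.cast_injective (α := k))
  convert h1 using 1
  ext d b
  rw [mem_weightSpace, Function.comp_apply, Module.End.mem_eigenspace_iff]
  rfl

theorem eq_zero_of_sum_weight_eq_zero [CharZero k] {ι : Type*} {w : ι → ℤ}
    (hw : Function.Injective w) {s : Finset ι} {v : ι → B}
    (hv : ∀ i ∈ s, v i ∈ weightSpace D U (w i)) (hs : ∑ i ∈ s, v i = 0) : ∀ i ∈ s, v i = 0 :=
  (iSupIndep_iff_finsetSum_eq_zero_imp_eq_zero _).1 ((iSupIndep_weightSpace D U).comp hw) s v hv hs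

/-- The kernel of `D` is spanned by highest weight vectors. -/
theorem IsFundamentalPair.mem_span_of_left_eq_zero [CharZero k] (h : IsFundamentalPair D U) {f : B}
    (hf : D f = 0) :
    f ∈ Submodule.span k {x | ∃ e : ℕ, D x = 0 ∧ x ∈ weightSpace D U e} := by
  obtain ⟨v, hv, rfl⟩ := (Submodule.mem_iSup_iff_exists_finsupp (weightSpace D U) f).1
    (by rw [show iSup (weightSpace D U) = ⊤ from h.sum_eq_top]; trivial)
  -- The vectors `D (v d)` have distinct weights `d + 2` and sum to `Df = 0`.
  have hD : ∀ d ∈ v.support, D (v d) = 0 :=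
    eq_zero_of_sum_weight_eq_zero (add_left_injective (2 : ℤ)) (fun d _ => h.left_mem (hv d))
      (by rw [← map_sum]; exact hf)
  refine Submodule.sum_mem _ fun d hd => Submodule.subset_span ?_
  obtain ⟨m, rfl, -⟩ := h.exists_weight_eq_natCast (hv d) (by rw [hD d hd, map_zero])
    (Finsupp.mem_support_iff.1 hd)
  exact ⟨m, hD _ hd, hv _⟩

/-! ### The Reynolds decomposition -/

/-- The Casimir operator `4UD + E² + 2E` with `E = [D,U]`. -/
def casimir (D U : Derivation k B B) : Module.End k B :=
  (4 : k) • (U.toLinearMap ∘ₗ D.toLinearMap) +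
    (⁅D, U⁆ : Derivation k B B).toLinearMap ∘ₗ (⁅D, U⁆ : Derivation k B B).toLinearMap +
    (2 : k) • (⁅D, U⁆ : Derivation k B B).toLinearMap

theorem casimir_apply (b : B) :
    casimir D U b = (4 : k) • U (D b) + ⁅D, U⁆ (⁅D, U⁆ b) + (2 : k) • ⁅D, U⁆ b := rfl

theorem IsFundamentalPair.casimir_stringVector (h : IsFundamentalPair D U) {e : ℕ} {f : B}
    (hf : f ∈ weightSpace D U e) (hD : D f = 0) (i : ℕ) :
    casimir D U ((⇑U)^[i] f) = ((e : k) * (e + 2)) • (⇑U)^[i] f := by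
  have hw := mem_weightSpace.1 (h.iterate_right_mem hf i)
  rw [casimir_apply, hw, Derivation.map_smul, hw]
  cases i with
  | zero =>
    simp only [Function.iterate_zero, id_eq, hD, map_zero, smul_zero, zero_add, smul_smul,
      ← add_smul]
    congr 1
    push_cast
    ring
  | succ i =>
    rw [h.left_iterate_right hf (by rw [hD, map_zero]), Derivation.map_smul,
      ← Function.iterate_succ_apply' (⇑U)]
    simp only [smul_smul, ← add_smul]
    congr 1
    push_cast
    ring

/-- The common kernel of `D` and `U`. -/
def pairInvariants (D U : Derivation k B B) : Subalgebra k B := kerAlg D ⊓ kerAlg U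

theorem mem_pairInvariants {b : B} : b ∈ pairInvariants D U ↔ D b = 0 ∧ U b = 0 := Iff.rfl

/-- The subspace `DB + UB`. -/
def pairImage (D U : Derivation k B B) : Submodule k B :=
  LinearMap.range D.toLinearMap ⊔ LinearMap.range U.toLinearMap

theorem left_mem_pairImage (b : B) : D b ∈ pairImage D U :=
  Submodule.mem_sup_left ⟨b, rfl⟩

theorem right_mem_pairImage (b : B) : U b ∈ pairImage D U :=
  Submodule.mem_sup_right ⟨b, rfl⟩

/-- Invariants are constants for both derivations. This is the linearity over invariants that
Hilbert's argument asks of a Reynolds operator. -/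
theorem mul_mem_pairImage {a x : B} (ha : a ∈ pairInvariants D U) (hx : x ∈ pairImage D U) :
    a * x ∈ pairImage D U := by
  obtain ⟨_, ⟨y, rfl⟩, _, ⟨z, rfl⟩, rfl⟩ := Submodule.mem_sup.1 hx
  have h1 : a * (D y + U z) = D (a * y) + U (a * z) := by
    rw [Derivation.leibniz, Derivation.leibniz, ha.1, ha.2]
    simp [mul_add]
  exact (show a * (D y + U z) ∈ _ from h1 ▸ add_mem (left_mem_pairImage _) (right_mem_pairImage _))

namespace IsFundamentalPair

variable [CharZero k] (h : IsFundamentalPair D U)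
include h

/-- On a string, `U^i f` with `i > 0` is in the image of `U`; the top `f` is `e⁻¹ D(Uf)` when `e >
0`, and is invariant when `e = 0`. -/
theorem exists_add_mem_pairImage (b : B) :
    ∃ a ∈ pairInvariants D U, ∃ x ∈ pairImage D U, b = a + x := by
  suffices hs : (pairInvariants D U).toSubmodule ⊔ pairImage D U = ⊤ by
    obtain ⟨a, ha, x, hx, hb⟩ := Submodule.mem_sup.1 (hs ▸ Submodule.mem_top (x := b))
    exact ⟨a, ha, x, hx, hb.symm⟩
  rw [eq_top_iff, ← h.span_stringVectors, Submodule.span_le]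
  rintro _ ⟨e, i, f, hi, hD, hf, rfl⟩
  cases i with
  | succ i =>
    rw [Function.iterate_succ_apply']
    exact Submodule.mem_sup_right (right_mem_pairImage _)
  | zero =>
    have h1 := h.left_iterate_right hf (by rw [hD, map_zero]) 0
    cases e with
    | zero => exact Submodule.mem_sup_left ⟨hD, h.iterate_right_eq_zero hf hD⟩
    | succ e =>
      refine Submodule.mem_sup_right ?_
      have h2 : f = ((e + 1 : ℕ) : k)⁻¹ • D (U f) := by
        simp only [zero_add, Function.iterate_one, Function.iterate_zero, id_eq] at h1
        rw [h1, smul_smul]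
        push_cast
        rw [sub_zero, zero_add, one_mul, inv_mul_cancel₀, one_smul]
        exact Nat.cast_add_one_ne_zero e
      rw [Function.iterate_zero, id_eq, h2]
      exact Submodule.smul_mem _ _ (left_mem_pairImage _)

/-- Strings with `e = 0` are killed by `D` and `U`; on the others the Casimir eigenvalue `e(e+2)` is
nonzero. -/
theorem pairImage_le :
    pairImage D U ≤ ⨆ μ : k, ⨆ _ : μ ≠ 0, (casimir D U).eigenspace μ := by
  have key : ∀ b, D b ∈ (⨆ μ : k, ⨆ _ : μ ≠ 0, (casimir D U).eigenspace μ) ∧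
      U b ∈ (⨆ μ : k, ⨆ _ : μ ≠ 0, (casimir D U).eigenspace μ) := by
    intro b
    have hb : b ∈ Submodule.span k (stringVectors D U) := h.span_stringVectors ▸ trivial
    induction hb using Submodule.span_induction with
    | zero => simp
    | add x y _ _ hx hy =>
      rw [map_add, map_add]
      exact ⟨add_mem hx.1 hy.1, add_mem hx.2 hy.2⟩
    | smul a x _ hx =>
      rw [Derivation.map_smul, Derivation.map_smul]
      exact ⟨Submodule.smul_mem _ _ hx.1, Submodule.smul_mem _ _ hx.2⟩
    | mem x hx =>
      obtain ⟨e, i, f, hi, hD, hf, rfl⟩ := hx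
      cases e with
      | zero =>
        obtain rfl : i = 0 := by omega
        have hU : U f = 0 := h.iterate_right_eq_zero hf hD
        simp [hD, hU]
      | succ e =>
        have hmem : ∀ j, (⇑U)^[j] f ∈ (⨆ μ : k, ⨆ _ : μ ≠ 0, (casimir D U).eigenspace μ) := by
          intro j
          refine Submodule.mem_iSup_of_mem (((e + 1 : ℕ) : k) * ((e + 1 : ℕ) + 2))
            (Submodule.mem_iSup_of_mem ?_
              (Module.End.mem_eigenspace_iff.2 (h.casimir_stringVector hf hD j)))
          exact_mod_cast (by positivity : (e + 1) * (e + 1 + 2) ≠ 0)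
        refine ⟨?_, by rw [← Function.iterate_succ_apply' (⇑U)]; exact hmem _⟩
        cases i with
        | zero => simp [hD]
        | succ i =>
          rw [h.left_iterate_right hf (by rw [hD, map_zero])]
          exact Submodule.smul_mem _ _ (hmem i)
  refine sup_le ?_ ?_
  · rintro _ ⟨b, rfl⟩
    exact (key b).1
  · rintro _ ⟨b, rfl⟩
    exact (key b).2

/-- Invariants lie in the Casimir eigenspace for 0, which is independent of the sum of the
eigenspaces for nonzero eigenvalues. -/
theorem eq_zero_of_mem_pairImage {a : B} (ha : a ∈ pairInvariants D U)
    (hx : a ∈ pairImage D U) : a = 0 := by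
  have h1 := (casimir D U).eigenspaces_iSupIndep (0 : k)
  refine Submodule.disjoint_def.1 h1 a ?_ (h.pairImage_le hx)
  have hE : ⁅D, U⁆ a = 0 := by
    rw [Derivation.commutator_apply, mem_pairInvariants.1 ha |>.1, mem_pairInvariants.1 ha |>.2,
      map_zero, map_zero, sub_zero]
  simp [casimir_apply, hE, (mem_pairInvariants.1 ha).1]

end IsFundamentalPair

end Weight

/-! ### Locally nilpotent derivations and their exponentials -/

section Exp

variable {k : Type*} [Field k] {B : Type*} [CommRing B] [Algebra k B] {D : Derivation k B B}

theorem iterate_eq_zero_of_le {b : B} {m n : ℕ} (hm : (⇑D)^[m] b = 0) (hmn : m ≤ n) :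
    (⇑D)^[n] b = 0 := by
  obtain ⟨i, rfl⟩ := Nat.exists_eq_add_of_le' hmn
  rw [Function.iterate_add_apply, hm, iterate_map_zero]

theorem iterate_mul_eq_zero {a b : B} {m n : ℕ} (ha : (⇑D)^[m] a = 0) (hb : (⇑D)^[n] b = 0) :
    (⇑D)^[m + n] (a * b) = 0 := by
  induction m generalizing a b n with
  | zero => rw [show a = 0 from ha, zero_mul, iterate_map_zero]
  | succ m ihm =>
    induction n generalizing a b with
    | zero => rw [show b = 0 from hb, mul_zero, iterate_map_zero]
    | succ n ihn =>
      rw [← add_assoc, Function.iterate_succ_apply, Derivation.leibniz, iterate_map_add,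
        smul_eq_mul, smul_eq_mul, ihn ha hb, mul_comm b,
        show m + 1 + n = m + (n + 1) by omega, ihm (n := n + 1) ha hb, zero_add]

theorem isLocallyNilpotent_of_adjoin_eq_top {s : Set B} (hs : Algebra.adjoin k s = ⊤)
    (h : ∀ x ∈ s, ∃ n : ℕ, (⇑D)^[n] x = 0) : IsLocallyNilpotent D := by
  intro b
  have hb : b ∈ Algebra.adjoin k s := hs ▸ trivial
  induction hb using Algebra.adjoin_induction with
  | mem x hx => exact h x hx
  | algebraMap r => exact ⟨1, D.map_algebraMap r⟩
  | add x y _ _ hx hy =>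
    obtain ⟨m, hm⟩ := hx
    obtain ⟨n, hn⟩ := hy
    exact ⟨max m n, by rw [iterate_map_add, iterate_eq_zero_of_le hm (le_max_left _ _),
      iterate_eq_zero_of_le hn (le_max_right _ _), add_zero]⟩
  | mul x y _ _ hx hy =>
    obtain ⟨m, hm⟩ := hx
    obtain ⟨n, hn⟩ := hy
    exact ⟨m + n, iterate_mul_eq_zero hm hn⟩

theorem expDer_eq_sum (t : k) {b : B} {n : ℕ} (hn : (⇑D)^[n] b = 0) :
    expDer D t b = ∑ i ∈ Finset.range n, (t ^ i / (i.factorial : k)) • (⇑D)^[i] b := by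
  refine finsum_eq_sum_of_support_subset _ fun i hi => ?_
  by_contra h
  simp only [Finset.coe_range, Set.mem_Iio, not_lt] at h
  exact hi (by simp only [iterate_eq_zero_of_le hn h, smul_zero])

theorem expDer_of_apply_eq_zero (t : k) {b : B} (hb : D b = 0) : expDer D t b = b := by
  rw [expDer_eq_sum t (n := 1) hb]
  simp

theorem expDer_of_apply_apply_eq_zero (t : k) {b : B} (hb : D (D b) = 0) :
    expDer D t b = b + t • D b := by
  rw [expDer_eq_sum t (n := 2) hb]
  simp [Finset.sum_range_succ]

theorem map_expDer {C : Type*} [CommRing C] [Algebra k C] {D' : Derivation k C C}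
    (hD : IsLocallyNilpotent D) (φ : B →ₗ[k] C) (hφ : ∀ b, φ (D b) = D' (φ b)) (t : k) (b : B) :
    φ (expDer D t b) = expDer D' t (φ b) := by
  obtain ⟨n, hn⟩ := hD b
  have h : ∀ i, φ ((⇑D)^[i] b) = (⇑D')^[i] (φ b) := fun i =>
    (Function.Semiconj.iterate_right (f := φ) hφ i) b
  rw [expDer_eq_sum t hn, expDer_eq_sum t (n := n) (by rw [← h, hn, map_zero]), map_sum]
  simp only [map_smul, h]

theorem iterate_leibniz (D : Derivation k B B) (n : ℕ) (a b : B) :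
    (⇑D)^[n] (a * b) =
      ∑ ij ∈ Finset.HasAntidiagonal.antidiagonal n, n.choose ij.1 • ((⇑D)^[ij.1] a * (⇑D)^[ij.2] b) := by
  induction n with
  | zero => simp
  | succ n ih =>
    rw [Finset.sum_antidiagonal_choose_succ_nsmul
      (M := B) (fun i j => ((⇑D)^[i] a) * ((⇑D)^[j] b)) n,
      Function.iterate_succ_apply', ih, map_sum, ← Finset.sum_add_distrib]
    refine Finset.sum_congr rfl fun ⟨i, j⟩ hij => ?_
    rw [map_nsmul, Derivation.leibniz, nsmul_add]
    simp only [smul_eq_mul, Function.iterate_succ_apply']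
    rw [← Nat.choose_symm_of_eq_add (Finset.HasAntidiagonal.mem_antidiagonal.1 hij).symm, mul_comm ((⇑D)^[j] b)]

/-- The exponential series is an honest polynomial in the parameter, so multiplicativity of
`exp(tD)` reduces to comparing coefficients by the Leibniz rule. -/
theorem exists_expPoly (hD : IsLocallyNilpotent D) (b : B) :
    ∃ p : Polynomial B, ∀ i, p.coeff i = (i.factorial : k)⁻¹ • (⇑D)^[i] b := by
  obtain ⟨n, hn⟩ := hD b
  refine ⟨∑ i ∈ Finset.range n, Polynomial.monomial i ((i.factorial : k)⁻¹ • (⇑D)^[i] b),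
    fun i => ?_⟩
  rw [Polynomial.finsetSum_coeff]
  simp only [Polynomial.coeff_monomial, Finset.sum_ite_eq', Finset.mem_range]
  split_ifs with h
  · rfl
  · rw [iterate_eq_zero_of_le hn (not_lt.1 h), smul_zero]

theorem expDer_eq_eval {p : Polynomial B} {b : B}
    (hp : ∀ i, p.coeff i = (i.factorial : k)⁻¹ • (⇑D)^[i] b) (t : k) :
    expDer D t b = p.eval (algebraMap k B t) := by
  have h : ∀ i, (t ^ i / (i.factorial : k)) • (⇑D)^[i] b = p.coeff i * algebraMap k B t ^ i := by
    intro i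
    rw [hp, div_eq_mul_inv, mul_smul, ← map_pow, mul_comm, ← Algebra.smul_def]
  rw [Polynomial.eval_eq_sum, Polynomial.sum, expDer, finsum_congr h]
  refine finsum_eq_sum_of_support_subset _ fun i hi => ?_
  rw [Finset.mem_coe, Polynomial.mem_support_iff]
  intro h0
  exact hi (by simp only [h0, zero_mul])

theorem expDer_mul [CharZero k] (hD : IsLocallyNilpotent D) (t : k) (a b : B) :
    expDer D t (a * b) = expDer D t a * expDer D t b := by
  obtain ⟨p, hp⟩ := exists_expPoly hD a
  obtain ⟨q, hq⟩ := exists_expPoly hD b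
  rw [expDer_eq_eval hp, expDer_eq_eval hq, ← Polynomial.eval_mul]
  refine expDer_eq_eval (fun n => ?_) t
  rw [Polynomial.coeff_mul, iterate_leibniz, Finset.smul_sum]
  refine Finset.sum_congr rfl fun ⟨i, j⟩ hij => ?_
  obtain rfl : i + j = n := Finset.HasAntidiagonal.mem_antidiagonal.1 hij
  rw [hp, hq, smul_mul_smul_comm, ← Nat.cast_smul_eq_nsmul k, smul_smul]
  congr 1
  rw [Nat.cast_add_choose]
  have h1 : ((i + j).factorial : k) ≠ 0 := Nat.cast_ne_zero.2 (Nat.factorial_ne_zero _)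
  field_simp

/-- The exponential of a locally nilpotent derivation as an algebra endomorphism. -/
def expAlgHom [CharZero k] (hD : IsLocallyNilpotent D) (t : k) : B →ₐ[k] B where
  toFun := expDer D t
  map_one' := expDer_of_apply_eq_zero t D.map_one_eq_zero
  map_mul' := expDer_mul hD t
  map_zero' := expDer_of_apply_eq_zero t (map_zero D)
  map_add' a b := by
    obtain ⟨m, hm⟩ := hD a
    obtain ⟨n, hn⟩ := hD b
    have ha := iterate_eq_zero_of_le hm (le_max_left m n)
    have hb := iterate_eq_zero_of_le hn (le_max_right m n)
    rw [expDer_eq_sum t ha, expDer_eq_sum t hb, ← Finset.sum_add_distrib,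
      expDer_eq_sum t (n := max m n) (by rw [iterate_map_add, ha, hb, add_zero])]
    simp only [iterate_map_add, smul_add]
  commutes' r := expDer_of_apply_eq_zero t (D.map_algebraMap r)

theorem expAlgHom_apply [CharZero k] (hD : IsLocallyNilpotent D) (t : k) (b : B) :
    expAlgHom hD t b = expDer D t b := rfl

/-- All `D^i b` are fixed too. If `D^(n+2) b = 0`, the exponential sends `D^n b` to `D^n b + D^(n+1)
b`, so already `D^(n+1) b = 0`; descend to `Db = 0`. -/
theorem apply_eq_zero_of_expDer_eq (hD : IsLocallyNilpotent D) {b : B}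
    (hb : expDer D 1 b = b) : D b = 0 := by
  have hfix : ∀ i, expDer D 1 ((⇑D)^[i] b) = (⇑D)^[i] b := by
    intro i
    induction i with
    | zero => exact hb
    | succ i ih =>
      rw [Function.iterate_succ_apply', ← D.coeFn_coe,
        ← map_expDer hD D.toLinearMap (fun _ => rfl)]
      exact congrArg D ih
  have key : ∀ n, (⇑D)^[n + 1] b = 0 → D b = 0 := by
    intro n
    induction n with
    | zero => exact id
    | succ n ih =>
      intro hn
      refine ih ?_
      have h1 := hfix n
      rw [expDer_of_apply_apply_eq_zero, one_smul, add_eq_left] at h1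
      · rwa [Function.iterate_succ_apply']
      · rwa [← Function.iterate_succ_apply' (⇑D), ← Function.iterate_succ_apply' (⇑D)]
  obtain ⟨n, hn⟩ := hD b
  exact key n (iterate_eq_zero_of_le hn n.le_succ)

end Exp

/-! ### Generation of `SL₂(k)` by unipotents -/

section Generation

variable {k : Type*} [Field k]

theorem coe_lowerUnip (t : k) : (lowerUnip t).1 = !![1, 0; t, 1] := rfl

theorem coe_upperUnip (s : k) : (upperUnip s).1 = !![1, s; 0, 1] := rfl

theorem mem_closure_unip_of_ne_zero {g : SL(2, k)} (hc : g.1 1 0 ≠ 0) :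
    g ∈ Submonoid.closure (Set.range (lowerUnip (k := k)) ∪ Set.range upperUnip) := by
  have hdet : g.1 0 0 * g.1 1 1 - g.1 0 1 * g.1 1 0 = 1 := by
    rw [← Matrix.det_fin_two]; exact g.2
  have hg : g = upperUnip ((g.1 0 0 - 1) / g.1 1 0) * lowerUnip (g.1 1 0) *
      upperUnip ((g.1 1 1 - 1) / g.1 1 0) := by
    apply Subtype.ext
    ext i j
    fin_cases i <;> fin_cases j <;>
      simp [coe_upperUnip, coe_lowerUnip, Matrix.mul_apply, Fin.sum_univ_two] <;> field_simp
    all_goals first | linear_combination -hdet | linear_combination (0 : k) * hdet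
  rw [hg]
  exact mul_mem (mul_mem (Submonoid.subset_closure (Or.inr ⟨_, rfl⟩))
    (Submonoid.subset_closure (Or.inl ⟨_, rfl⟩))) (Submonoid.subset_closure (Or.inr ⟨_, rfl⟩))

theorem closure_unip_eq_top :
    Submonoid.closure (Set.range (lowerUnip (k := k)) ∪ Set.range upperUnip) = ⊤ := by
  refine eq_top_iff.2 fun g _ => ?_
  by_cases hc : g.1 1 0 = 0
  · have hdet : g.1 0 0 * g.1 1 1 - g.1 0 1 * g.1 1 0 = 1 := by
      rw [← Matrix.det_fin_two]; exact g.2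
    -- With lower left entry 0 the upper left entry is a unit, and adding the first row to the
    -- second moves it into the corner.
    have h1 : (lowerUnip 1 * g).1 1 0 ≠ 0 := by
      have : (lowerUnip 1 * g).1 1 0 = g.1 0 0 := by
        simp [coe_lowerUnip, Matrix.mul_apply, Fin.sum_univ_two, hc]
      rw [this]
      intro h0
      simp [h0, hc] at hdet
    have h2 : g = lowerUnip (-1) * (lowerUnip 1 * g) := by
      rw [← mul_assoc]
      convert (one_mul g).symm
      apply Subtype.ext
      ext i j
      fin_cases i <;> fin_cases j <;>
        simp [coe_lowerUnip, Matrix.mul_apply, Fin.sum_univ_two]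
    rw [h2]
    exact mul_mem (Submonoid.subset_closure (Or.inl ⟨_, rfl⟩)) (mem_closure_unip_of_ne_zero h1)
  · exact mem_closure_unip_of_ne_zero hc

end Generation

/-! ### The standard action on `k[X, Y]` -/

section Standard

variable (k : Type*) [Field k]

/-- The derivation `X ∂_Y` of `k[X, Y]`. -/
def stdD : Derivation k (MvPolynomial (Fin 2) k) (MvPolynomial (Fin 2) k) :=
  (X 0 : MvPolynomial (Fin 2) k) • pderiv 1

/-- The derivation `Y ∂_X` of `k[X, Y]`. -/
def stdU : Derivation k (MvPolynomial (Fin 2) k) (MvPolynomial (Fin 2) k) :=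
  (X 1 : MvPolynomial (Fin 2) k) • pderiv 0

variable {k}

theorem stdD_X_zero : stdD k (X 0) = 0 := by simp [stdD, pderiv_X]
theorem stdD_X_one : stdD k (X 1) = X 0 := by simp [stdD]
theorem stdU_X_zero : stdU k (X 0) = X 1 := by simp [stdU]
theorem stdU_X_one : stdU k (X 1) = 0 := by simp [stdU, pderiv_X]

theorem isLocallyNilpotent_stdD : IsLocallyNilpotent (stdD k) := by
  refine isLocallyNilpotent_of_adjoin_eq_top (adjoin_range_X) ?_
  rintro _ ⟨i, rfl⟩
  refine ⟨2, ?_⟩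
  fin_cases i
  · simp [stdD_X_zero]
  · simp [stdD_X_zero, stdD_X_one]

theorem isLocallyNilpotent_stdU : IsLocallyNilpotent (stdU k) := by
  refine isLocallyNilpotent_of_adjoin_eq_top (adjoin_range_X) ?_
  rintro _ ⟨i, rfl⟩
  refine ⟨2, ?_⟩
  fin_cases i
  · simp [stdU_X_zero, stdU_X_one]
  · simp [stdU_X_one]

/-- The linear substitution of `k[X, Y]` given by a matrix acting on the basis `Y, X` of the
linear forms. -/
def matrixSubst (g : SL(2, k)) : MvPolynomial (Fin 2) k →ₐ[k] MvPolynomial (Fin 2) k :=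
  aeval ![C (g.1 0 1) * X 1 + C (g.1 1 1) * X 0, C (g.1 0 0) * X 1 + C (g.1 1 0) * X 0]

theorem matrixSubst_mul (g h : SL(2, k)) :
    matrixSubst (g * h) = (matrixSubst g).comp (matrixSubst h) := by
  refine algHom_ext fun i => ?_
  fin_cases i
  · simp [matrixSubst, Matrix.mul_apply, Fin.sum_univ_two, algHom_C]
    ring
  · simp [matrixSubst, Matrix.mul_apply, Fin.sum_univ_two, algHom_C]
    ring

theorem matrixSubst_one : matrixSubst (1 : SL(2, k)) = AlgHom.id k _ := by
  refine algHom_ext fun i => ?_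
  fin_cases i <;> simp [matrixSubst]

theorem matrixSubst_lowerUnip [CharZero k] (t : k) :
    matrixSubst (lowerUnip t) = expAlgHom isLocallyNilpotent_stdD t := by
  refine algHom_ext fun i => ?_
  fin_cases i
  · simp [matrixSubst, lowerUnip, expAlgHom_apply, expDer_of_apply_eq_zero, stdD_X_zero]
  · simp [matrixSubst, lowerUnip, expAlgHom_apply, expDer_of_apply_apply_eq_zero, stdD_X_zero,
      stdD_X_one, smul_eq_C_mul]

theorem matrixSubst_upperUnip [CharZero k] (s : k) :
    matrixSubst (upperUnip s) = expAlgHom isLocallyNilpotent_stdU s := by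
  refine algHom_ext fun i => ?_
  fin_cases i
  · simp [matrixSubst, upperUnip, expAlgHom_apply, expDer_of_apply_apply_eq_zero, stdU_X_zero,
      stdU_X_one, smul_eq_C_mul, add_comm]
  · simp [matrixSubst, upperUnip, expAlgHom_apply, expDer_of_apply_eq_zero, stdU_X_one]

/-- The coefficients of `matrixSubst g p` are polynomials in the entries of `g`. -/
theorem exists_matrixSubst_eq_map (p : MvPolynomial (Fin 2) k) :
    ∃ q : MvPolynomial (Fin 2) (MvPolynomial (Fin 2 × Fin 2) k), ∀ g : SL(2, k),
      matrixSubst g p = map (eval fun x => g.1 x.1 x.2) q := by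
  induction p using MvPolynomial.induction_on with
  | C a => exact ⟨C (C a), fun g => by simp [algHom_C]⟩
  | add p₁ p₂ h₁ h₂ =>
    obtain ⟨q₁, h₁⟩ := h₁
    obtain ⟨q₂, h₂⟩ := h₂
    exact ⟨q₁ + q₂, fun g => by rw [map_add, map_add, h₁, h₂]⟩
  | mul_X p i hp =>
    obtain ⟨q, hp⟩ := hp
    refine ⟨q * ![C (X (0, 1)) * X 1 + C (X (1, 1)) * X 0,
      C (X (0, 0)) * X 1 + C (X (1, 0)) * X 0] i, fun g => ?_⟩
    rw [map_mul, map_mul, hp]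
    fin_cases i <;> simp [matrixSubst]

end Standard

/-! ### Intertwiners from `k[X, Y]` -/

section Intertwiner

variable {k : Type*} [Field k] {B : Type*} [CommRing B] [Algebra k B] {D U : Derivation k B B}

/-- The linear map `k[X, Y] → B` that sends `X^a Y^i` with `a + i = e` to `a! U^i f` and kills the
monomials of degree different from `e`. -/
def stringMap (U : Derivation k B B) (e : ℕ) (f : B) : MvPolynomial (Fin 2) k →ₗ[k] B :=
  (basisMonomials (Fin 2) k).constr k fun m =>
    if m 0 + m 1 = e then ((m 0).factorial : k) • (⇑U)^[m 1] f else 0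

theorem stringMap_monomial (e : ℕ) (f : B) (m : Fin 2 →₀ ℕ) (r : k) :
    stringMap U e f (monomial m r) =
      r • if m 0 + m 1 = e then ((m 0).factorial : k) • (⇑U)^[m 1] f else 0 := by
  have h : monomial m r = r • basisMonomials (Fin 2) k m := by
    simp [coe_basisMonomials, smul_monomial]
  rw [h, map_smul, stringMap, Module.Basis.constr_basis]

theorem stdD_monomial (m : Fin 2 →₀ ℕ) :
    stdD k (monomial m 1) =
      monomial (m - Finsupp.single 1 1 + Finsupp.single 0 1) (m 1 : k) := by
  simp [stdD, pderiv_monomial, X, monomial_mul, add_comm]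

theorem stdU_monomial (m : Fin 2 →₀ ℕ) :
    stdU k (monomial m 1) =
      monomial (m - Finsupp.single 0 1 + Finsupp.single 1 1) (m 0 : k) := by
  simp [stdU, pderiv_monomial, X, monomial_mul, add_comm]

namespace IsFundamentalPair

variable (h : IsFundamentalPair D U) {e : ℕ} {f : B} (hf : f ∈ weightSpace D U e) (hD : D f = 0)
include h hf hD

/-- On `X^a Y^(i+1)` of degree `e` both sides are `(i+1)(a+1)! U^i f`, because `e - i = a + 1`. The
factor `a!` in `stringMap` is chosen for this. -/
theorem stringMap_stdD (p : MvPolynomial (Fin 2) k) :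
    stringMap U e f (stdD k p) = D (stringMap U e f p) := by
  suffices hs : stringMap U e f ∘ₗ (stdD k).toLinearMap = D.toLinearMap ∘ₗ stringMap U e f from
    LinearMap.congr_fun hs p
  refine (basisMonomials (Fin 2) k).ext fun m => ?_
  rw [coe_basisMonomials]
  change stringMap U e f (stdD k (monomial m 1)) = D (stringMap U e f (monomial m 1))
  rw [stdD_monomial, stringMap_monomial, stringMap_monomial]
  obtain ⟨a, ha⟩ : ∃ a, m 0 = a := ⟨_, rfl⟩
  obtain ⟨i, hi⟩ : ∃ i, m 1 = i := ⟨_, rfl⟩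
  cases i with
  | zero => simp [hi, hD, apply_ite D]
  | succ i =>
    simp only [hi, Finsupp.add_apply, Finsupp.tsub_apply, ha]
    simp only [Fin.isValue, ne_eq, one_ne_zero, not_false_eq_true, Finsupp.single_eq_of_ne,
      Finsupp.single_eq_same, add_tsub_cancel_right, add_zero, tsub_zero, one_smul, zero_ne_one]
    have hiff : a + 1 + i = e ↔ a + (i + 1) = e := by omega
    by_cases hae : a + (i + 1) = e
    · rw [if_pos (hiff.2 hae), if_pos hae, Derivation.map_smul,
        h.left_iterate_right hf (by rw [hD, map_zero]), smul_smul, smul_smul, ← hae]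
      congr 1
      push_cast [Nat.factorial_succ]
      ring
    · rw [if_neg (hiff.not.2 hae), if_neg hae, smul_zero, map_zero]

variable [CharZero k]

theorem stringMap_stdU (p : MvPolynomial (Fin 2) k) :
    stringMap U e f (stdU k p) = U (stringMap U e f p) := by
  suffices hs : stringMap U e f ∘ₗ (stdU k).toLinearMap = U.toLinearMap ∘ₗ stringMap U e f from
    LinearMap.congr_fun hs p
  refine (basisMonomials (Fin 2) k).ext fun m => ?_
  rw [coe_basisMonomials]
  change stringMap U e f (stdU k (monomial m 1)) = U (stringMap U e f (monomial m 1))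
  rw [stdU_monomial, stringMap_monomial, stringMap_monomial]
  obtain ⟨a, ha⟩ : ∃ a, m 0 = a := ⟨_, rfl⟩
  obtain ⟨i, hi⟩ : ∃ i, m 1 = i := ⟨_, rfl⟩
  -- On `Y^e` the left side vanishes, and the right side does because `U^(e+1) f = 0`.
  cases a with
  | zero =>
    rw [ha, hi, zero_add, Nat.cast_zero, zero_smul, one_smul]
    by_cases hie : i = e
    · subst hie
      rw [if_pos rfl, Derivation.map_smul, ← Function.iterate_succ_apply' (⇑U),
        h.iterate_right_eq_zero hf hD, smul_zero]
    · rw [if_neg hie, map_zero]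
  | succ a =>
    simp only [hi, Finsupp.add_apply, Finsupp.tsub_apply, ha]
    simp only [Fin.isValue, ne_eq, one_ne_zero, not_false_eq_true, Finsupp.single_eq_of_ne,
      Finsupp.single_eq_same, add_tsub_cancel_right, add_zero, tsub_zero, one_smul, zero_ne_one]
    have hiff : a + (i + 1) = e ↔ a + 1 + i = e := by omega
    by_cases hae : a + 1 + i = e
    · rw [if_pos (hiff.2 hae), if_pos hae, Derivation.map_smul,
        ← Function.iterate_succ_apply' (⇑U), smul_smul]
      congr 1
      push_cast [Nat.factorial_succ]
      ring
    · rw [if_neg (hiff.not.2 hae), if_neg hae, smul_zero, map_zero]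

end IsFundamentalPair

variable [CharZero k]

theorem IsFundamentalPair.span_stringMap (h : IsFundamentalPair D U) :
    Submodule.span k {b | ∃ (e : ℕ) (f : B) (p : MvPolynomial (Fin 2) k), D f = 0 ∧
      f ∈ weightSpace D U e ∧ stringMap U e f p = b} = ⊤ := by
  rw [eq_top_iff, ← h.span_stringVectors, Submodule.span_le]
  rintro _ ⟨e, i, f, hi, hD, hf, rfl⟩
  refine Submodule.subset_span ⟨e, f, monomial (Finsupp.single 0 (e - i) + Finsupp.single 1 i)
    (((e - i).factorial : k)⁻¹), hD, hf, ?_⟩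
  have h0 : ((e - i).factorial : k) ≠ 0 := Nat.cast_ne_zero.2 (Nat.factorial_ne_zero _)
  rw [stringMap_monomial, if_pos (by simp [hi])]
  simp [smul_smul, inv_mul_cancel₀ h0]

end Intertwiner

/-! ### The action defined by a fundamental pair -/

section Action

variable {k : Type*} [Field k] [CharZero k] {B : Type*} [CommRing B] [Algebra k B]
  {D U : Derivation k B B}

/-- The endomorphism `α` of `B` is compatible with the substitution by `g` under all the
intertwiners `stringMap`. -/
def Realizes (D U : Derivation k B B) (α : B →ₐ[k] B) (g : SL(2, k)) : Prop :=
  ∀ (e : ℕ) (f : B), D f = 0 → f ∈ weightSpace D U e → ∀ p : MvPolynomial (Fin 2) k,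
    α (stringMap U e f p) = stringMap U e f (matrixSubst g p)

omit [CharZero k] in
theorem Realizes.mul {α β : B →ₐ[k] B} {g g' : SL(2, k)} (hα : Realizes D U α g)
    (hβ : Realizes D U β g') : Realizes D U (α * β) (g * g') := by
  intro e f hD hf p
  rw [matrixSubst_mul, AlgHom.mul_apply, hβ e f hD hf, hα e f hD hf]
  rfl

omit [CharZero k] in
theorem realizes_one : Realizes D U 1 1 := by
  intro e f hD hf p
  rw [matrixSubst_one]
  rfl

namespace IsFundamentalPair

variable (h : IsFundamentalPair D U)
include h

theorem realizes_unique {α β : B →ₐ[k] B} {g : SL(2, k)} (hα : Realizes D U α g)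
    (hβ : Realizes D U β g) : α = β := by
  have hs : α.toLinearMap = β.toLinearMap := by
    refine LinearMap.ext_on h.span_stringMap ?_
    rintro _ ⟨e, f, p, hD, hf, rfl⟩
    exact (hα e f hD hf p).trans (hβ e f hD hf p).symm
  exact AlgHom.ext fun b => LinearMap.congr_fun hs b

theorem realizes_lowerUnip (t : k) :
    Realizes D U (expAlgHom h.locallyNilpotent_left t) (lowerUnip t) := by
  intro e f hD hf p
  rw [matrixSubst_lowerUnip, expAlgHom_apply, expAlgHom_apply]
  exact (map_expDer isLocallyNilpotent_stdD _ (h.stringMap_stdD hf hD) t p).symm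

theorem realizes_upperUnip (s : k) :
    Realizes D U (expAlgHom h.locallyNilpotent_right s) (upperUnip s) := by
  intro e f hD hf p
  rw [matrixSubst_upperUnip, expAlgHom_apply, expAlgHom_apply]
  exact (map_expDer isLocallyNilpotent_stdU _ (h.stringMap_stdU hf hD) s p).symm

/-- Write `g` as a product of unipotents and compose exponentials. By `realizes_unique` the result
does not depend on the factorization, so no relations of `SL₂(k)` need checking. -/
theorem exists_realizes (g : SL(2, k)) : ∃ α : B →ₐ[k] B, Realizes D U α g := by
  have hg : g ∈ Submonoid.closure (Set.range (lowerUnip (k := k)) ∪ Set.range upperUnip) :=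
    closure_unip_eq_top (k := k) ▸ Submonoid.mem_top g
  induction hg using Submonoid.closure_induction with
  | mem x hx =>
    rcases hx with ⟨t, rfl⟩ | ⟨s, rfl⟩
    · exact ⟨_, h.realizes_lowerUnip t⟩
    · exact ⟨_, h.realizes_upperUnip s⟩
  | one => exact ⟨1, realizes_one⟩
  | mul x y _ _ hx hy =>
    obtain ⟨α, hα⟩ := hx
    obtain ⟨β, hβ⟩ := hy
    exact ⟨α * β, hα.mul hβ⟩

/-- The action of `SL₂(k)` defined by a fundamental pair, by algebra endomorphisms. -/
def actionHom : SL(2, k) →* (B →ₐ[k] B) where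
  toFun g := (h.exists_realizes g).choose
  map_one' := h.realizes_unique (h.exists_realizes 1).choose_spec realizes_one
  map_mul' g g' := h.realizes_unique (h.exists_realizes (g * g')).choose_spec
    ((h.exists_realizes g).choose_spec.mul (h.exists_realizes g').choose_spec)

theorem realizes_actionHom (g : SL(2, k)) : Realizes D U (h.actionHom g) g :=
  (h.exists_realizes g).choose_spec

/-- The action of `SL₂(k)` defined by a fundamental pair. -/
def action : SL(2, k) →* (B ≃ₐ[k] B) :=
  (AlgEquiv.algHomUnitsEquiv k B).toMonoidHom.comp h.actionHom.toHomUnits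

theorem action_apply (g : SL(2, k)) (b : B) : h.action g b = h.actionHom g b := rfl

theorem isAlgebraicAction_action : IsAlgebraicAction h.action := by
  intro b
  suffices hs : ∃ (ι : Type) (_ : Fintype ι) (P : ι → MvPolynomial (Fin 2 × Fin 2) k) (c : ι → B),
      ∀ g : SL(2, k), h.actionHom g b = ∑ i, eval (fun x => g.1 x.1 x.2) (P i) • c i by
    obtain ⟨ι, _, P, c, hP⟩ := hs
    refine ⟨Fintype.card ι, P ∘ (Fintype.equivFin ι).symm, c ∘ (Fintype.equivFin ι).symm,
      fun g => ?_⟩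
    rw [h.action_apply, hP]
    exact ((Fintype.equivFin ι).symm.sum_comp
      fun i => eval (fun x => g.1 x.1 x.2) (P i) • c i).symm
  have hb : b ∈ Submodule.span k _ := h.span_stringMap ▸ Submodule.mem_top
  induction hb using Submodule.span_induction with
  | mem x hx =>
    obtain ⟨e, f, p, hD, hf, rfl⟩ := hx
    obtain ⟨q, hq⟩ := exists_matrixSubst_eq_map p
    refine ⟨q.support, inferInstance, fun m => q.coeff m,
      fun m => stringMap U e f (monomial m.1 1), fun g => ?_⟩
    rw [h.realizes_actionHom g e f hD hf, hq, Finset.sum_coe_sort q.support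
      (fun m => eval (fun x => g.1 x.1 x.2) (q.coeff m) • stringMap U e f (monomial m 1))]
    conv_lhs => rw [q.as_sum]
    rw [map_sum, map_sum]
    refine Finset.sum_congr rfl fun m _ => ?_
    rw [map_monomial, ← map_smul, smul_monomial, smul_eq_mul, mul_one]
  | zero => exact ⟨Empty, inferInstance, fun _ => 0, fun _ => 0, fun g => by simp⟩
  | add x y _ _ hx hy =>
    obtain ⟨ι, _, P, c, hP⟩ := hx
    obtain ⟨κ, _, Q, d, hQ⟩ := hy
    exact ⟨ι ⊕ κ, inferInstance, Sum.elim P Q, Sum.elim c d, fun g => by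
      rw [map_add, hP, hQ, Fintype.sum_sum_type]; rfl⟩
  | smul a x _ hx =>
    obtain ⟨ι, _, P, c, hP⟩ := hx
    exact ⟨ι, inferInstance, P, fun i => a • c i, fun g => by
      rw [map_smul, hP, Finset.smul_sum]
      exact Finset.sum_congr rfl fun i _ => smul_comm _ _ _⟩

theorem isActionOf_action : IsActionOf D U h.action where
  algebraic := h.isAlgebraicAction_action
  lower t b := by
    rw [h.action_apply, h.realizes_unique (h.realizes_actionHom _) (h.realizes_lowerUnip t)]
    rfl
  upper s b := by
    rw [h.action_apply, h.realizes_unique (h.realizes_actionHom _) (h.realizes_upperUnip s)]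
    rfl

theorem existsUnique_action : ∃! ρ : SL(2, k) →* (B ≃ₐ[k] B), IsActionOf D U ρ := by
  refine ⟨h.action, h.isActionOf_action, fun ρ hρ => ?_⟩
  refine MonoidHom.eq_of_eqOn_denseM closure_unip_eq_top ?_
  rintro _ (⟨t, rfl⟩ | ⟨s, rfl⟩)
  · exact AlgEquiv.ext fun b => (hρ.lower t b).trans (h.isActionOf_action.lower t b).symm
  · exact AlgEquiv.ext fun b => (hρ.upper s b).trans (h.isActionOf_action.upper s b).symm

omit [CharZero k] in
-- A vector fixed by `exp(D)` and `exp(U)` is killed by both derivations; conversely the unipotents,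
-- which generate, fix such a vector.
theorem invariants_eq_pairInvariants {ρ : SL(2, k) →* (B ≃ₐ[k] B)} (hρ : IsActionOf D U ρ) :
    invariants ρ = pairInvariants D U := by
  ext b
  rw [mem_invariants, mem_pairInvariants]
  refine ⟨fun hb => ⟨?_, ?_⟩, fun hb g => ?_⟩
  · exact apply_eq_zero_of_expDer_eq h.locallyNilpotent_left (by rw [← hρ.lower, hb])
  · exact apply_eq_zero_of_expDer_eq h.locallyNilpotent_right (by rw [← hρ.upper, hb])
  · have hg : g ∈ Submonoid.closure (Set.range (lowerUnip (k := k)) ∪ Set.range upperUnip) :=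
      closure_unip_eq_top (k := k) ▸ Submonoid.mem_top g
    induction hg using Submonoid.closure_induction with
    | mem x hx =>
      rcases hx with ⟨t, rfl⟩ | ⟨s, rfl⟩
      · rw [hρ.lower, expDer_of_apply_eq_zero t hb.1]
      · rw [hρ.upper, expDer_of_apply_eq_zero s hb.2]
    | one => rw [map_one]; rfl
    | mul x y _ _ hx hy => rw [map_mul, AlgEquiv.mul_apply, hy, hx]

end IsFundamentalPair

end Action

/-! ### The extended pair on `B[X, Y]` -/

section Extension

variable {k : Type*} [Field k] {B : Type*} [CommRing B] [Algebra k B] {D U : Derivation k B B}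

theorem extD_C (b : B) : extD D (C b) = C (D b) := by simp [extD, coeffDer_C]
theorem extD_X_zero : extD D (X 0) = 0 := by simp [extD, coeffDer_X, pderiv_X]
theorem extD_X_one : extD D (X 1) = X 0 := by simp [extD, coeffDer_X]
theorem extU_C (b : B) : extU U (C b) = C (U b) := by simp [extU, coeffDer_C]
theorem extU_X_zero : extU U (X 0) = X 1 := by simp [extU, coeffDer_X]
theorem extU_X_one : extU U (X 1) = 0 := by simp [extU, coeffDer_X, pderiv_X]

theorem adjoin_range_C_union_range_X (k : Type*) [Field k] (B : Type*) [CommRing B] [Algebra k B]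
    (σ : Type*) :
    Algebra.adjoin k (Set.range (C : B → MvPolynomial σ B) ∪ Set.range X) = ⊤ := by
  refine eq_top_iff.2 fun p _ => ?_
  induction p using MvPolynomial.induction_on with
  | C a => exact Algebra.subset_adjoin (Or.inl ⟨a, rfl⟩)
  | add p q hp hq => exact add_mem (hp trivial) (hq trivial)
  | mul_X p i hp => exact mul_mem (hp trivial) (Algebra.subset_adjoin (Or.inr ⟨i, rfl⟩))

theorem iSup_weightSpace_eq_top_of_adjoin {s : Set B} (hs : Algebra.adjoin k s = ⊤)
    (h : ∀ x ∈ s, x ∈ ⨆ d : ℤ, weightSpace D U d) : ⨆ d : ℤ, weightSpace D U d = ⊤ := by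
  refine eq_top_iff.2 fun b _ => ?_
  have hb : b ∈ Algebra.adjoin k s := hs ▸ Algebra.mem_top
  induction hb using Algebra.adjoin_induction with
  | mem x hx => exact h x hx
  | algebraMap r => exact Submodule.mem_iSup_of_mem 0 (algebraMap_mem_weightSpace r)
  | add x y _ _ hx hy => exact add_mem (hx trivial) (hy trivial)
  | mul x y _ _ hx hy =>
    have hle : (⨆ d : ℤ, weightSpace D U d) * (⨆ d : ℤ, weightSpace D U d) ≤
        ⨆ d : ℤ, weightSpace D U d := by
      rw [Submodule.iSup_mul, iSup_le_iff]
      intro d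
      rw [Submodule.mul_iSup, iSup_le_iff]
      intro e
      refine (Submodule.mul_le.2 fun a ha b hb => ?_)
      exact Submodule.mem_iSup_of_mem _ (weightSpace_mul_mem ha hb)
    exact hle (Submodule.mul_mem_mul (hx trivial) (hy trivial))

/-- To be a fundamental pair can be checked on algebra generators. -/
theorem isFundamentalPair_of_adjoin_eq_top {s : Set B} (hs : Algebra.adjoin k s = ⊤)
    (hD : ∀ x ∈ s, ∃ n : ℕ, (⇑D)^[n] x = 0) (hU : ∀ x ∈ s, ∃ n : ℕ, (⇑U)^[n] x = 0)
    (hDE : ∀ x ∈ s, ⁅D, U⁆ (D x) = D (⁅D, U⁆ x) + (2 : k) • D x)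
    (hUE : ∀ x ∈ s, ⁅D, U⁆ (U x) = U (⁅D, U⁆ x) - (2 : k) • U x)
    (hE : ∀ x ∈ s, x ∈ ⨆ d : ℤ, weightSpace D U d) : IsFundamentalPair D U where
  locallyNilpotent_left := isLocallyNilpotent_of_adjoin_eq_top hs hD
  locallyNilpotent_right := isLocallyNilpotent_of_adjoin_eq_top hs hU
  lie_left := by
    refine Derivation.ext_of_adjoin_eq_top s hs fun x hx => ?_
    rw [Derivation.commutator_apply, hDE x hx, Derivation.smul_apply, neg_smul]
    abel
  lie_right := by
    refine Derivation.ext_of_adjoin_eq_top s hs fun x hx => ?_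
    rw [Derivation.commutator_apply, hUE x hx, Derivation.smul_apply]
    abel
  sum_eq_top := iSup_weightSpace_eq_top_of_adjoin hs hE

theorem lie_ext_C (b : B) : ⁅extD D, extU U⁆ (C b) = C (⁅D, U⁆ b) := by
  simp [Derivation.commutator_apply, extD_C, extU_C]

theorem lie_ext_X_zero : ⁅extD D, extU U⁆ (X 0) = X 0 := by
  simp [Derivation.commutator_apply, extD_X_zero, extD_X_one, extU_X_zero]

theorem lie_ext_X_one : ⁅extD D, extU U⁆ (X 1) = -X 1 := by
  simp [Derivation.commutator_apply, extU_X_one, extD_X_one, extU_X_zero]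

theorem IsFundamentalPair.ext (h : IsFundamentalPair D U) :
    IsFundamentalPair (extD D) (extU U) := by
  have hCD : ∀ n b, (⇑(extD D))^[n] (C b) = C ((⇑D)^[n] b) := fun n b =>
    ((Function.Semiconj.iterate_right (f := C) (fun b => (extD_C b).symm) n) b).symm
  have hCU : ∀ n b, (⇑(extU U))^[n] (C b) = C ((⇑U)^[n] b) := fun n b =>
    ((Function.Semiconj.iterate_right (f := C) (fun b => (extU_C b).symm) n) b).symm
  have hsm : ∀ (r : k) (b : B), (C (r • b) : MvPolynomial (Fin 2) B) = r • C b := fun r b => by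
    rw [C_apply, C_apply, smul_monomial]
  refine isFundamentalPair_of_adjoin_eq_top (adjoin_range_C_union_range_X k B (Fin 2))
    ?_ ?_ ?_ ?_ ?_
  all_goals
    rintro _ (⟨b, rfl⟩ | ⟨i, rfl⟩)
  · obtain ⟨n, hn⟩ := h.locallyNilpotent_left b
    exact ⟨n, by rw [hCD, hn, C_0]⟩
  · refine ⟨2, ?_⟩
    fin_cases i <;> simp [extD_X_zero, extD_X_one]
  · obtain ⟨n, hn⟩ := h.locallyNilpotent_right b
    exact ⟨n, by rw [hCU, hn, C_0]⟩
  · refine ⟨2, ?_⟩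
    fin_cases i <;> simp [extU_X_zero, extU_X_one]
  · rw [extD_C, lie_ext_C, lie_ext_C, extD_C, h.lie_apply_left, C_add, hsm]
  · fin_cases i
    · simp [extD_X_zero, lie_ext_X_zero]
    · simp only [Fin.mk_one, extD_X_one, lie_ext_X_zero, lie_ext_X_one, map_neg, two_smul]
      abel
  · rw [extU_C, lie_ext_C, lie_ext_C, extU_C, h.lie_apply_right, C_sub, hsm]
  · fin_cases i
    · simp only [Fin.zero_eta, extU_X_zero, lie_ext_X_zero, lie_ext_X_one, two_smul]
      abel
    · simp [extU_X_one, lie_ext_X_one]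
  · have hb : b ∈ ⨆ d : ℤ, weightSpace D U d := by
      rw [show (⨆ d : ℤ, weightSpace D U d) = ⊤ from h.sum_eq_top]; trivial
    induction hb using Submodule.iSup_induction' with
    | mem d x hx =>
      refine Submodule.mem_iSup_of_mem d ?_
      rw [mem_weightSpace] at *
      rw [lie_ext_C, hx, hsm]
    | zero => rw [C_0]; exact zero_mem _
    | add x y _ _ hx hy => rw [C_add]; exact add_mem hx hy
  · fin_cases i
    · refine Submodule.mem_iSup_of_mem 1 ?_
      simp [mem_weightSpace, lie_ext_X_zero]
    · refine Submodule.mem_iSup_of_mem (-1) ?_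
      simp [mem_weightSpace, lie_ext_X_one]

/-! ### Coefficients of the extended pair -/

/-- The exponent of `X^i Y^j`. -/
def biexp (i j : ℕ) : Fin 2 →₀ ℕ := Finsupp.single 0 i + Finsupp.single 1 j

theorem biexp_zero (i j : ℕ) : biexp i j 0 = i := by simp [biexp]
theorem biexp_one (i j : ℕ) : biexp i j 1 = j := by simp [biexp]

theorem biexp_self (m : Fin 2 →₀ ℕ) : biexp (m 0) (m 1) = m := by
  ext i
  fin_cases i <;> simp [biexp]

theorem ext_biexp {p q : MvPolynomial (Fin 2) B}
    (h : ∀ i j, coeff (biexp i j) p = coeff (biexp i j) q) : p = q := by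
  ext m
  rw [← biexp_self m, h]

theorem coeff_coeffDer {σ : Type*} (m : σ →₀ ℕ) (p : MvPolynomial σ B) :
    coeff m (coeffDer D p) = D (coeff m p) := by
  classical
  induction p using MvPolynomial.induction_on' with
  | add p q hp hq => rw [map_add, coeff_add, coeff_add, hp, hq, map_add]
  | monomial n b =>
    rw [show coeffDer D (monomial n b) = monomial n (D b) from coeffLin_monomial D n b,
      coeff_monomial, coeff_monomial, apply_ite D, map_zero]

theorem coeff_extD (m : Fin 2 →₀ ℕ) (p : MvPolynomial (Fin 2) B) :
    coeff m (extD D p) = D (coeff m p) + coeff m (X 0 * pderiv 1 p) := by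
  rw [← coeff_coeffDer]; rfl

theorem coeff_extU (m : Fin 2 →₀ ℕ) (p : MvPolynomial (Fin 2) B) :
    coeff m (extU U p) = U (coeff m p) + coeff m (X 1 * pderiv 0 p) := by
  rw [← coeff_coeffDer]; rfl

theorem coeff_extD_zero (j : ℕ) (p : MvPolynomial (Fin 2) B) :
    coeff (biexp 0 j) (extD D p) = D (coeff (biexp 0 j) p) := by
  rw [coeff_extD, coeff_X_mul', if_neg (by simp [biexp_zero]), add_zero]

theorem coeff_extD_succ (i j : ℕ) (p : MvPolynomial (Fin 2) B) :
    coeff (biexp (i + 1) j) (extD D p) =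
      D (coeff (biexp (i + 1) j) p) + coeff (biexp i (j + 1)) p * (j + 1) := by
  have h1 : biexp (i + 1) j = Finsupp.single 0 1 + biexp i j := by
    rw [biexp, biexp, Finsupp.single_add]; abel
  rw [coeff_extD]
  congr 1
  rw [h1, coeff_X_mul, coeff_pderiv, biexp_one, biexp, biexp, Finsupp.single_add, add_assoc]

theorem coeff_extU_zero (i : ℕ) (p : MvPolynomial (Fin 2) B) :
    coeff (biexp i 0) (extU U p) = U (coeff (biexp i 0) p) := by
  rw [coeff_extU, coeff_X_mul', if_neg (by simp [biexp_one]), add_zero]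

theorem coeff_extU_succ (i j : ℕ) (p : MvPolynomial (Fin 2) B) :
    coeff (biexp i (j + 1)) (extU U p) =
      U (coeff (biexp i (j + 1)) p) + coeff (biexp (i + 1) j) p * (i + 1) := by
  have h1 : biexp i (j + 1) = Finsupp.single 1 1 + biexp i j := by
    rw [biexp, biexp, Finsupp.single_add]; abel
  have h2 : biexp (i + 1) j = biexp i j + Finsupp.single 0 1 := by
    rw [biexp, biexp, Finsupp.single_add]; abel
  rw [coeff_extU]
  congr 1
  rw [h1, coeff_X_mul, coeff_pderiv, biexp_zero, h2]

/-- The evaluation of `B[X, Y]` at `X = 0`, `Y = 1`. -/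
def evalY (k : Type*) [Field k] (B : Type*) [CommRing B] [Algebra k B] :
    MvPolynomial (Fin 2) B →ₐ[k] B :=
  (aeval ![(0 : B), 1]).restrictScalars k

/-- The extra term `X∂_Y` vanishes at `X = 0`. -/
theorem evalY_extD (p : MvPolynomial (Fin 2) B) :
    evalY k B (extD D p) = D (evalY k B p) := by
  induction p using MvPolynomial.induction_on with
  | C a => simp [evalY, extD_C, algHom_C]
  | add p q hp hq => simp only [map_add, hp, hq]
  | mul_X p i hp =>
    rw [Derivation.leibniz, map_add, smul_eq_mul, smul_eq_mul, map_mul, map_mul, hp, map_mul,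
      Derivation.leibniz]
    fin_cases i <;> simp [evalY, extD_X_zero, extD_X_one]

theorem exists_evalY_eq_sum (p : MvPolynomial (Fin 2) B) :
    ∃ N, ∀ M, N ≤ M → evalY k B p = ∑ j ∈ Finset.range M, coeff (biexp 0 j) p := by
  classical
  induction p using MvPolynomial.induction_on' with
  | add p q hp hq =>
    obtain ⟨N, hN⟩ := hp
    obtain ⟨N', hN'⟩ := hq
    refine ⟨max N N', fun M hM => ?_⟩
    simp only [map_add, coeff_add, Finset.sum_add_distrib]
    rw [hN M (le_trans (le_max_left _ _) hM), hN' M (le_trans (le_max_right _ _) hM)]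
  | monomial m b =>
    refine ⟨m 1 + 1, fun M hM => ?_⟩
    have h1 : evalY k B (monomial m b) = if m 0 = 0 then b else 0 := by
      simp [evalY, aeval_monomial, Finsupp.prod_fintype, zero_pow_eq]
    have h2 : ∀ j, coeff (biexp 0 j) (monomial m b) =
        if j = m 1 then (if m 0 = 0 then b else 0) else 0 := by
      intro j
      rw [coeff_monomial]
      by_cases hm : m = biexp 0 j
      · rw [if_pos hm, hm, biexp_zero, biexp_one, if_pos rfl, if_pos rfl]
      · rw [if_neg hm]
        split_ifs with h3 h4
        · exact absurd (by rw [← biexp_self m, h3, h4]) hm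
        · rfl
        · rfl
    simp only [h1, h2, Finset.sum_ite_eq', Finset.mem_range]
    rw [if_pos (by omega : m 1 < M)]

end Extension

/-! ### The kernel of `D` and the invariants of the extended pair -/

section Kernel

variable {k : Type*} [Field k] [CharZero k] {B : Type*} [CommRing B] [Algebra k B]
  {D U : Derivation k B B}

/-- The coefficient of `Y^j` has weight `j`, so a vanishing sum of these coefficients makes each
vanish. Invariance under `U + Y∂_X` then determines the coefficients in `X^(i+1)` from those in
`X^i`. -/
theorem eq_zero_of_evalY_eq_zero {p : MvPolynomial (Fin 2) B}
    (hp : p ∈ pairInvariants (extD D) (extU U)) (h0 : evalY k B p = 0) : p = 0 := by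
  obtain ⟨hD, hU⟩ := mem_pairInvariants.1 hp
  have hw : ∀ j : ℕ, coeff (biexp 0 j) p ∈ weightSpace D U (j : ℤ) := by
    intro j
    have h1 : D (coeff (biexp 0 j) p) = 0 := by rw [← coeff_extD_zero, hD, coeff_zero]
    rw [mem_weightSpace, Derivation.commutator_apply, h1, map_zero, sub_zero]
    cases j with
    | zero => rw [← coeff_extU_zero, hU]; simp
    | succ j =>
      have h2 := coeff_extU_succ (U := U) 0 j p
      rw [hU, coeff_zero, Nat.cast_zero, zero_add, zero_add, mul_one, eq_comm, add_eq_zero_iff_eq_neg] at h2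
      have h3 := coeff_extD_succ (D := D) 0 j p
      rw [hD, coeff_zero, eq_comm, add_eq_zero_iff_eq_neg] at h3
      rw [h2, map_neg, zero_add] at *
      rw [h3, neg_neg, Algebra.smul_def, mul_comm]
      simp
  obtain ⟨N, hN⟩ := exists_evalY_eq_sum (k := k) p
  have hz : ∀ j, coeff (biexp 0 j) p = 0 := by
    intro j
    -- The range must be long enough for the evaluation formula and must also contain `j`.
    refine eq_zero_of_sum_weight_eq_zero (w := fun j : ℕ => (j : ℤ)) Nat.cast_injective
      (s := Finset.range (max N (j + 1))) (fun i _ => hw i) ?_ j (by simp)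
    rw [← hN _ (le_max_left _ _), h0]
  refine ext_biexp fun i => ?_
  induction i with
  | zero => exact fun j => by rw [hz, coeff_zero]
  | succ i ih =>
    intro j
    have h2 := coeff_extU_succ (U := U) i j p
    rw [hU, ih, coeff_zero, map_zero, zero_add, eq_comm] at h2
    have h3 : ((i : k) + 1) • coeff (biexp (i + 1) j) p = 0 := by
      rw [Algebra.smul_def, mul_comm, ← h2]
      simp
    rw [coeff_zero]
    exact (smul_eq_zero.1 h3).resolve_left (Nat.cast_add_one_ne_zero i)

/-- The binary form `∑ (-1)^i / i! U^i f X^i Y^(e-i)`. -/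
def stringForm (U : Derivation k B B) (e : ℕ) (f : B) : MvPolynomial (Fin 2) B :=
  ∑ i ∈ Finset.range (e + 1),
    monomial (biexp i (e - i)) (((-1) ^ i * (i.factorial : k)⁻¹) • (⇑U)^[i] f)

omit [CharZero k] in
theorem coeff_stringForm (e : ℕ) (f : B) (i j : ℕ) :
    coeff (biexp i j) (stringForm U e f) =
      if i + j = e then ((-1) ^ i * (i.factorial : k)⁻¹) • (⇑U)^[i] f else 0 := by
  classical
  have hinj : ∀ a : ℕ, biexp a (e - a) = biexp i j ↔ a = i ∧ e - a = j := fun a =>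
    ⟨fun h => ⟨by rw [← biexp_zero a (e - a), h, biexp_zero],
      by rw [← biexp_one a (e - a), h, biexp_one]⟩, fun h => by rw [h.1, ← h.2, h.1]⟩
  rw [stringForm, coeff_sum]
  simp only [coeff_monomial, hinj]
  split_ifs with h
  · rw [Finset.sum_eq_single i]
    · rw [if_pos ⟨rfl, by omega⟩]
    · exact fun a _ ha => if_neg fun h => ha h.1
    · exact fun hi => absurd (Finset.mem_range.2 (by omega)) hi
  · refine Finset.sum_eq_zero fun a ha => if_neg fun h' => h ?_
    have := Finset.mem_range.1 ha
    omega

/-- Neighbouring coefficients cancel: the sign alternates, the factorials absorb the factor `i + 1`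
from differentiating, and `e - i = j + 1` matches the factor from `D U^(i+1) f`. -/
theorem IsFundamentalPair.stringForm_mem (h : IsFundamentalPair D U) {e : ℕ} {f : B}
    (hf : f ∈ weightSpace D U e) (hD : D f = 0) :
    stringForm U e f ∈ pairInvariants (extD D) (extU U) := by
  have hfac : ∀ i : ℕ, (i.factorial : k) ≠ 0 := fun i =>
    Nat.cast_ne_zero.2 (Nat.factorial_ne_zero i)
  have hmul : ∀ (b : B) (j : ℕ), b * ((j : B) + 1) = ((j : k) + 1) • b := fun b j => by
    rw [Algebra.smul_def, mul_comm]; simp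
  refine mem_pairInvariants.2 ⟨ext_biexp fun i j => ?_, ext_biexp fun i j => ?_⟩
  · rw [coeff_zero]
    cases i with
    | zero =>
      rw [coeff_extD_zero, coeff_stringForm]
      split_ifs
      · simp [hD]
      · exact map_zero D
    | succ i =>
      rw [coeff_extD_succ, coeff_stringForm, coeff_stringForm, hmul]
      by_cases hij : i + (j + 1) = e
      · rw [if_pos (by omega), if_pos hij, Derivation.map_smul,
          h.left_iterate_right hf (by rw [hD, map_zero]), smul_smul, smul_smul, ← add_smul, ← hij]
        convert zero_smul k _
        have h1 := hfac i
        have h2 : (i : k) + 1 ≠ 0 := Nat.cast_add_one_ne_zero i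
        push_cast [Nat.factorial_succ]
        field_simp
        ring
      · rw [if_neg (by omega), if_neg hij, map_zero, smul_zero, add_zero]
  · rw [coeff_zero]
    cases j with
    | zero =>
      rw [coeff_extU_zero, coeff_stringForm]
      split_ifs with hi
      · obtain rfl : i = e := hi
        rw [Derivation.map_smul, ← Function.iterate_succ_apply' (⇑U),
          h.iterate_right_eq_zero hf hD, smul_zero]
      · exact map_zero U
    | succ j =>
      rw [coeff_extU_succ, coeff_stringForm, coeff_stringForm, hmul]
      by_cases hij : i + (j + 1) = e
      · rw [if_pos hij, if_pos (by omega), Derivation.map_smul,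
          ← Function.iterate_succ_apply' (⇑U), smul_smul, ← add_smul]
        convert zero_smul k _
        have h1 := hfac i
        have h2 : (i : k) + 1 ≠ 0 := Nat.cast_add_one_ne_zero i
        push_cast [Nat.factorial_succ]
        field_simp
        ring
      · rw [if_neg hij, if_neg (by omega), map_zero, smul_zero, add_zero]

omit [CharZero k] in
theorem evalY_stringForm (e : ℕ) (f : B) : evalY k B (stringForm U e f) = f := by
  obtain ⟨N, hN⟩ := exists_evalY_eq_sum (k := k) (stringForm U e f)
  rw [hN _ (le_max_left N (e + 1))]
  simp [coeff_stringForm]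

/-- The evaluation at `X = 0`, `Y = 1` maps the invariants of the extended pair to `ker D`. -/
def evalInvariants (D U : Derivation k B B) :
    pairInvariants (extD D) (extU U) →ₐ[k] kerAlg D :=
  ((evalY k B).comp (pairInvariants (extD D) (extU U)).val).codRestrict (kerAlg D) fun p => by
    rw [mem_kerAlg, AlgHom.comp_apply, ← evalY_extD]
    exact (congrArg _ p.2.1).trans (map_zero _)

theorem IsFundamentalPair.bijective_evalInvariants (h : IsFundamentalPair D U) :
    Function.Bijective (evalInvariants D U) := by
  refine ⟨(injective_iff_map_eq_zero _).2 fun p hp => Subtype.ext ?_, fun f => ?_⟩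
  · exact eq_zero_of_evalY_eq_zero p.2 (congrArg Subtype.val hp)
  · suffices hs : f.1 ∈ (pairInvariants (extD D) (extU U)).toSubmodule.map
        (evalY k B).toLinearMap by
      obtain ⟨p, hp, hpf⟩ := hs
      exact ⟨⟨p, hp⟩, Subtype.ext hpf⟩
    refine Submodule.span_le.2 ?_ (h.mem_span_of_left_eq_zero f.2)
    rintro x ⟨e, hD, hx⟩
    exact ⟨stringForm U e x, h.stringForm_mem hx hD, evalY_stringForm e x⟩

/-- The kernel of `D` is the algebra of invariants of the extended pair. -/
def IsFundamentalPair.kerEquiv (h : IsFundamentalPair D U) :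
    kerAlg D ≃ₐ[k] pairInvariants (extD D) (extU U) :=
  (AlgEquiv.ofBijective _ h.bijective_evalInvariants).symm

end Kernel

/-! ### Hilbert's finiteness theorem for linear pairs on polynomial rings -/

section Hilbert

variable {k : Type*} [Field k] {σ : Type*}
  {D U : Derivation k (MvPolynomial σ k) (MvPolynomial σ k)}

theorem isHomogeneous_derivation_monomial (hD : ∀ i, (D (X i)).IsHomogeneous 1) (s : σ →₀ ℕ) :
    (D (monomial s 1)).IsHomogeneous s.degree := by
  induction s using Finsupp.induction_linear with
  | zero =>
    rw [← C_apply, C_1, Derivation.map_one_eq_zero]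
    exact isHomogeneous_zero _ _ _
  | add s t hs ht =>
    rw [← one_mul (1 : k), ← monomial_mul, Derivation.leibniz, map_add]
    refine ((isHomogeneous_monomial _ rfl).mul ht).add ?_
    rw [add_comm]
    exact (isHomogeneous_monomial _ rfl).mul hs
  | single i n =>
    rw [← X_pow_eq_monomial, Derivation.leibniz_pow, Finsupp.degree_single]
    cases n with
    | zero => rw [zero_smul]; exact isHomogeneous_zero _ _ _
    | succ n =>
      rw [← Nat.cast_smul_eq_nsmul k, smul_eq_C_mul]
      exact ((isHomogeneous_X_pow i n).mul (hD i)).C_mul _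

theorem homogeneousComponent_derivation (hD : ∀ i, (D (X i)).IsHomogeneous 1) (n : ℕ)
    (p : MvPolynomial σ k) :
    homogeneousComponent n (D p) = D (homogeneousComponent n p) := by
  induction p using MvPolynomial.induction_on' with
  | add p q hp hq => simp only [map_add, hp, hq]
  | monomial s r =>
    rw [show monomial s r = r • monomial s (1 : k) by rw [smul_monomial, smul_eq_mul, mul_one],
      Derivation.map_smul, map_smul, map_smul, Derivation.map_smul,
      homogeneousComponent_of_mem (isHomogeneous_derivation_monomial hD s),
      homogeneousComponent_of_mem (isHomogeneous_monomial (1 : k) rfl), apply_ite D, map_zero]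

theorem homogeneousComponent_mem_pairInvariants (hD : ∀ i, (D (X i)).IsHomogeneous 1)
    (hU : ∀ i, (U (X i)).IsHomogeneous 1) {p : MvPolynomial σ k} (hp : p ∈ pairInvariants D U)
    (n : ℕ) : homogeneousComponent n p ∈ pairInvariants D U := by
  rw [mem_pairInvariants] at *
  rw [← homogeneousComponent_derivation hD, ← homogeneousComponent_derivation hU, hp.1, hp.2,
    map_zero]
  exact ⟨rfl, rfl⟩

variable [CharZero k] [Finite σ]

/-- Finitely many homogeneous invariants generating the ideal of all positive-degree ones also
generate the algebra: linear pairs preserve degree, so one can induct on it. -/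
theorem IsFundamentalPair.fg_pairInvariants_of_linear (h : IsFundamentalPair D U)
    (hD : ∀ i, (D (X i)).IsHomogeneous 1) (hU : ∀ i, (U (X i)).IsHomogeneous 1) :
    (pairInvariants D U).FG := by
  set S : Set (MvPolynomial σ k) :=
    {a | a ∈ pairInvariants D U ∧ ∃ d, 0 < d ∧ a.IsHomogeneous d} with hS
  obtain ⟨t, htS, ht⟩ := (Submodule.fg_span_iff_fg_span_finset_subset S).1
    (IsNoetherian.noetherian (Ideal.span S))
  have htA : Algebra.adjoin k (t : Set (MvPolynomial σ k)) ≤ pairInvariants D U :=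
    Algebra.adjoin_le fun x hx => (htS hx).1
  have key : ∀ d, ∀ a ∈ pairInvariants D U, a.IsHomogeneous d →
      a ∈ Algebra.adjoin k (t : Set (MvPolynomial σ k)) := by
    intro d
    induction d using Nat.strong_induction_on with
    | _ d ih =>
      intro a ha had
      rcases Nat.eq_zero_or_pos d with rfl | hd
      · rw [← homogeneousComponent_eq_self had, homogeneousComponent_zero]
        exact Subalgebra.algebraMap_mem _ _
      · have haS : a ∈ Submodule.span (MvPolynomial σ k) (t : Set (MvPolynomial σ k)) :=
          ht ▸ Submodule.subset_span ⟨ha, d, hd, had⟩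
        obtain ⟨c, -, hc⟩ := Submodule.mem_span_finset.1 haS
        -- Replace each coefficient by its invariant part `r f`; the error is invariant and lies in
        -- the image, hence is zero.
        choose r hr q hq hrq using fun f => h.exists_add_mem_pairImage (c f)
        have ha' : a = ∑ f ∈ t, r f * f := by
          have h1 : a - ∑ f ∈ t, r f * f = ∑ f ∈ t, f * q f := by
            rw [← hc, ← Finset.sum_sub_distrib]
            refine Finset.sum_congr rfl fun f _ => ?_
            rw [smul_eq_mul, hrq f]
            ring
          rw [← sub_eq_zero]
          refine h.eq_zero_of_mem_pairImage (sub_mem ha (sum_mem fun f hf =>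
            mul_mem (hr f) (htS hf).1)) ?_
          rw [h1]
          exact sum_mem fun f hf => mul_mem_pairImage (htS hf).1 (hq f)
        rw [← homogeneousComponent_eq_self had, ha', map_sum]
        refine sum_mem fun f hf => ?_
        obtain ⟨hfA, e, he, hfe⟩ := htS hf
        rw [← sum_homogeneousComponent (r f), Finset.sum_mul, map_sum]
        refine sum_mem fun i _ => ?_
        rw [homogeneousComponent_of_mem ((homogeneousComponent_isHomogeneous i (r f)).mul hfe)]
        split_ifs with hi
        -- Here `i + e = d` with `e > 0`, so induction applies to the degree `i` part of `r f`.
        · exact mul_mem (ih i (by omega) _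
            (homogeneousComponent_mem_pairInvariants hD hU (hr f) i)
            (homogeneousComponent_isHomogeneous i _)) (Algebra.subset_adjoin hf)
        · exact zero_mem _
  refine ⟨t, le_antisymm htA fun a ha => ?_⟩
  rw [← sum_homogeneousComponent a]
  exact sum_mem fun i _ => key i _ (homogeneousComponent_mem_pairInvariants hD hU ha i)
    (homogeneousComponent_isHomogeneous i a)

end Hilbert

/-! ### Equivariant surjections -/

section Equivariant

variable {k : Type*} [Field k] {A : Type*} [CommRing A] [Algebra k A] {B : Type*} [CommRing B]
  [Algebra k B]

theorem map_derivation_of_adjoin_eq_top {D : Derivation k A A} {D' : Derivation k B B}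
    (φ : A →ₐ[k] B) {s : Set A} (hs : Algebra.adjoin k s = ⊤)
    (h : ∀ x ∈ s, φ (D x) = D' (φ x)) (a : A) : φ (D a) = D' (φ a) := by
  have ha : a ∈ Algebra.adjoin k s := hs ▸ Algebra.mem_top
  induction ha using Algebra.adjoin_induction with
  | mem x hx => exact h x hx
  | algebraMap r => simp
  | add x y _ _ hx hy => simp only [map_add, hx, hy]
  | mul x y _ _ hx hy =>
    simp only [Derivation.leibniz, map_add, map_mul, smul_eq_mul, hx, hy]

/-- Invariants lift: if `φ(a + y)` is invariant with `a` invariant and `y` in the image, then `φ y`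
is both invariant and in the image, hence zero. -/
theorem fg_pairInvariants_of_surjective [CharZero k] {D U : Derivation k A A}
    {D' U' : Derivation k B B}
    (h : IsFundamentalPair D U) (h' : IsFundamentalPair D' U') (φ : A →ₐ[k] B)
    (hφ : Function.Surjective φ) (hD : ∀ a, φ (D a) = D' (φ a)) (hU : ∀ a, φ (U a) = U' (φ a))
    (hfg : (pairInvariants D U).FG) : (pairInvariants D' U').FG := by
  have hle : ∀ a ∈ pairInvariants D U, φ a ∈ pairInvariants D' U' := by
    intro a ha
    rw [mem_pairInvariants] at *
    rw [← hD, ← hU, ha.1, ha.2, map_zero]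
    exact ⟨rfl, rfl⟩
  have hmap : (pairInvariants D U).map φ = pairInvariants D' U' := by
    refine le_antisymm ?_ fun b hb => ?_
    · rintro _ ⟨a, ha, rfl⟩
      exact hle a ha
    · obtain ⟨x, rfl⟩ := hφ b
      obtain ⟨a, ha, y, hy, rfl⟩ := h.exists_add_mem_pairImage x
      refine ⟨a, ha, ?_⟩
      obtain ⟨_, ⟨u, rfl⟩, _, ⟨v, rfl⟩, rfl⟩ := Submodule.mem_sup.1 hy
      have h1 : φ (a + (D u + U v)) - φ a = D' (φ u) + U' (φ v) := by
        rw [← hD, ← hU, map_add, map_add]; abel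
      rw [eq_comm, ← sub_eq_zero]
      refine h'.eq_zero_of_mem_pairImage (sub_mem hb (hle a ha)) ?_
      exact (show φ (a + (D u + U v)) - φ a ∈ _ from
        h1 ▸ add_mem (left_mem_pairImage _) (right_mem_pairImage _))
  exact hmap ▸ hfg.map φ

end Equivariant

/-! ### The polynomial pair on strings of variables -/

section StringPolynomial

variable (k : Type*) [Field k] {T : Type*} (e : T → ℕ)

/-- The variable with indices `t`, `j`, or zero if `j` is out of range. -/
def stringVar (t : T) (j : ℕ) : MvPolynomial (Σ t, Fin (e t + 1)) k :=
  if h : j < e t + 1 then X ⟨t, j, h⟩ else 0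

/-- The raising derivation on strings of variables. -/
def stringD : Derivation k (MvPolynomial (Σ t, Fin (e t + 1)) k)
    (MvPolynomial (Σ t, Fin (e t + 1)) k) :=
  -- At index 0 the truncated subtraction is harmless, since the coefficient is 0.
  mkDerivation k fun x => ((x.2 : k) * (e x.1 - x.2 + 1)) • stringVar k e x.1 (x.2 - 1)

/-- The lowering derivation on strings of variables. -/
def stringU : Derivation k (MvPolynomial (Σ t, Fin (e t + 1)) k)
    (MvPolynomial (Σ t, Fin (e t + 1)) k) :=
  mkDerivation k fun x => stringVar k e x.1 (x.2 + 1)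

variable {k e}

theorem stringVar_of_lt {t : T} {j : ℕ} (h : j < e t + 1) :
    stringVar k e t j = X ⟨t, j, h⟩ := dif_pos h

theorem stringVar_of_le {t : T} {j : ℕ} (h : e t + 1 ≤ j) : stringVar k e t j = 0 :=
  dif_neg h.not_gt

theorem isHomogeneous_stringVar (t : T) (j : ℕ) : (stringVar k e t j).IsHomogeneous 1 := by
  rw [stringVar]
  split_ifs
  · exact isHomogeneous_X _ _
  · exact isHomogeneous_zero _ _ _

theorem stringD_stringVar_zero (t : T) : stringD k e (stringVar k e t 0) = 0 := by
  rw [stringVar_of_lt (Nat.succ_pos _), stringD, mkDerivation_X]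
  simp

theorem stringD_stringVar_succ (t : T) (j : ℕ) :
    stringD k e (stringVar k e t (j + 1)) = (((j : k) + 1) * (e t - j)) • stringVar k e t j := by
  rcases lt_trichotomy j (e t) with h | rfl | h
  · rw [stringVar_of_lt (Nat.succ_lt_succ h), stringD, mkDerivation_X]
    dsimp only
    rw [Nat.succ_eq_add_one, Nat.add_sub_cancel]
    congr 1
    push_cast
    ring
  -- Just past the end of the string the variable is 0, and so is the factor `e t - j`.
  · rw [stringVar_of_le le_rfl, map_zero, sub_self, mul_zero, zero_smul]
  · rw [stringVar_of_le (by omega), stringVar_of_le (by omega), map_zero, smul_zero]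

theorem stringU_stringVar (t : T) (j : ℕ) :
    stringU k e (stringVar k e t j) = stringVar k e t (j + 1) := by
  rcases lt_or_ge j (e t + 1) with h | h
  · rw [stringVar_of_lt h, stringU, mkDerivation_X]
  · rw [stringVar_of_le h, stringVar_of_le (by omega), map_zero]

theorem lie_stringVar (t : T) (j : ℕ) :
    ⁅stringD k e, stringU k e⁆ (stringVar k e t j) = ((e t : k) - 2 * j) • stringVar k e t j := by
  rw [Derivation.commutator_apply, stringU_stringVar, stringD_stringVar_succ]
  cases j with
  | zero => simp [stringD_stringVar_zero]
  | succ j =>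
    rw [stringD_stringVar_succ, Derivation.map_smul, stringU_stringVar, ← sub_smul]
    congr 1
    push_cast
    ring

theorem iterate_stringU_stringVar (t : T) (n : ℕ) :
    ∀ j, (⇑(stringU k e))^[n] (stringVar k e t j) = stringVar k e t (j + n) := by
  induction n with
  | zero => exact fun j => rfl
  | succ n ih =>
    intro j
    rw [Function.iterate_succ_apply, stringU_stringVar, ih]
    congr 1
    omega

theorem iterate_stringD_stringVar (t : T) (j : ℕ) :
    (⇑(stringD k e))^[j + 1] (stringVar k e t j) = 0 := by
  induction j with
  | zero => exact stringD_stringVar_zero t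
  | succ j ih =>
    have hsmul : ∀ (n : ℕ) (r : k) p, (⇑(stringD k e))^[n] (r • p) =
        r • (⇑(stringD k e))^[n] p := fun n r p =>
      (Function.Semiconj.iterate_right (f := (r • ·))
        (fun p => ((stringD k e).map_smul r p).symm) n p).symm
    rw [Function.iterate_succ_apply, stringD_stringVar_succ, hsmul, ih, smul_zero]

theorem isFundamentalPair_string : IsFundamentalPair (stringD k e) (stringU k e) := by
  have hX : ∀ x : Σ t, Fin (e t + 1), (X x : MvPolynomial _ k) = stringVar k e x.1 x.2 :=
    fun x => (stringVar_of_lt x.2.2).symm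
  refine isFundamentalPair_of_adjoin_eq_top adjoin_range_X ?_ ?_ ?_ ?_ ?_
  all_goals
    rintro _ ⟨x, rfl⟩
    rw [hX]
    generalize (x.2 : ℕ) = j
    generalize x.1 = t
  · exact ⟨j + 1, iterate_stringD_stringVar t j⟩
  · exact ⟨e t + 1, by rw [iterate_stringU_stringVar, stringVar_of_le (by omega)]⟩
  · cases j with
    | zero => simp [stringD_stringVar_zero, lie_stringVar]
    | succ j =>
      rw [lie_stringVar, stringD_stringVar_succ, Derivation.map_smul, Derivation.map_smul,
        lie_stringVar, stringD_stringVar_succ, smul_smul, smul_smul, smul_smul, ← add_smul]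
      congr 1
      push_cast
      ring
  · rw [lie_stringVar, stringU_stringVar, Derivation.map_smul, lie_stringVar, stringU_stringVar,
      ← sub_smul]
    congr 1
    push_cast
    ring
  · refine Submodule.mem_iSup_of_mem ((e t : ℤ) - 2 * j) ?_
    rw [mem_weightSpace, lie_stringVar]
    push_cast
    rfl

theorem isHomogeneous_stringD_X (x : Σ t, Fin (e t + 1)) :
    (stringD k e (X x)).IsHomogeneous 1 := by
  rw [stringD, mkDerivation_X, smul_eq_C_mul]
  exact (isHomogeneous_stringVar _ _).C_mul _

theorem isHomogeneous_stringU_X (x : Σ t, Fin (e t + 1)) :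
    (stringU k e (X x)).IsHomogeneous 1 := by
  rw [stringU, mkDerivation_X]
  exact isHomogeneous_stringVar _ _

end StringPolynomial

/-! ### Finite generation -/

section FiniteGeneration

variable {k : Type*} [Field k] [CharZero k] {B : Type*} [CommRing B] [Algebra k B]
  {D U : Derivation k B B}

theorem IsFundamentalPair.exists_finset_stringVectors [Algebra.FiniteType k B]
    (h : IsFundamentalPair D U) :
    ∃ T : Finset B, (T : Set B) ⊆ stringVectors D U ∧ Algebra.adjoin k (T : Set B) = ⊤ := by
  classical
  obtain ⟨s, hs⟩ := Algebra.FiniteType.out (R := k) (A := B)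
  have hx : ∀ x : B, ∃ T : Finset B, (T : Set B) ⊆ stringVectors D U ∧
      x ∈ Submodule.span k (T : Set B) := fun x =>
    Submodule.mem_span_finite_of_mem_span (h.span_stringVectors ▸ Submodule.mem_top)
  choose T hT hxT using hx
  refine ⟨s.biUnion T, fun b hb => ?_, ?_⟩
  · obtain ⟨x, -, hb⟩ := Finset.mem_biUnion.1 hb
    exact hT x hb
  · rw [eq_top_iff, ← hs]
    refine Algebra.adjoin_le fun x hx => ?_
    refine Algebra.span_le_adjoin k _ (Submodule.span_mono ?_ (hxT x))
    exact Finset.coe_subset.2 (Finset.subset_biUnion_of_mem T hx)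

/-- The common kernel of a fundamental pair on an affine algebra is finitely generated. -/
theorem IsFundamentalPair.fg_pairInvariants [Algebra.FiniteType k B]
    (h : IsFundamentalPair D U) : (pairInvariants D U).FG := by
  obtain ⟨T, hTs, hT⟩ := h.exists_finset_stringVectors
  choose e i f hi hD hf hx using fun t : T => hTs t.2
  -- Each generator in `T` lies on a string; whole strings are used as variables so that the linear
  -- pair maps to `(D, U)`.
  let φ : MvPolynomial (Σ t, Fin (e t + 1)) k →ₐ[k] B := aeval fun x => (⇑U)^[x.2] (f x.1)
  have hφ : ∀ t j, φ (stringVar k e t j) = (⇑U)^[j] (f t) := by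
    intro t j
    rcases lt_or_ge j (e t + 1) with hj | hj
    · rw [stringVar_of_lt hj]
      exact aeval_X _ _
    · rw [stringVar_of_le hj, map_zero,
        iterate_eq_zero_of_le (h.iterate_right_eq_zero (hf t) (hD t)) hj]
  have hX : ∀ x : Σ t, Fin (e t + 1), (X x : MvPolynomial _ k) = stringVar k e x.1 x.2 :=
    fun x => (stringVar_of_lt x.2.2).symm
  refine fg_pairInvariants_of_surjective isFundamentalPair_string h φ ?_ ?_ ?_
    (isFundamentalPair_string.fg_pairInvariants_of_linear isHomogeneous_stringD_X
      isHomogeneous_stringU_X)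
  · rw [← AlgHom.range_eq_top, eq_top_iff, ← hT]
    refine Algebra.adjoin_le fun x hxT => ⟨stringVar k e ⟨x, hxT⟩ (i ⟨x, hxT⟩), ?_⟩
    exact (hφ _ _).trans (hx ⟨x, hxT⟩)
  · refine map_derivation_of_adjoin_eq_top φ adjoin_range_X ?_
    rintro _ ⟨x, rfl⟩
    rw [hX, hφ]
    generalize (x.2 : ℕ) = j
    generalize x.1 = t
    cases j with
    | zero => rw [stringD_stringVar_zero, map_zero]; exact (hD t).symm
    | succ j =>
      rw [stringD_stringVar_succ, map_smul, hφ,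
        h.left_iterate_right (hf t) (by rw [hD, map_zero])]
      push_cast
      rfl
  · refine map_derivation_of_adjoin_eq_top φ adjoin_range_X ?_
    rintro _ ⟨x, rfl⟩
    rw [hX, hφ, stringU_stringVar, hφ, Function.iterate_succ_apply']

theorem IsFundamentalPair.fg_kerAlg [Algebra.FiniteType k B] (h : IsFundamentalPair D U) :
    (kerAlg D).FG := by
  have h1 : (pairInvariants (extD D) (extU U)).FG := by
    have : Algebra.FiniteType k (MvPolynomial (Fin 2) B) :=
      Algebra.FiniteType.trans (S := B) inferInstance inferInstance
    exact h.ext.fg_pairInvariants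
  have h2 := (Subalgebra.fg_iff_finiteType _).1 h1
  exact (Subalgebra.fg_iff_finiteType _).2 (h2.equiv h.kerEquiv.symm)

end FiniteGeneration

end FundPair

end

theorem mainTheorem8 {k : Type*} [Field k] [CharZero k] {B : Type*} [CommRing B] [IsDomain B]
    [Algebra k B] [Algebra.FiniteType k B] (D U : Derivation k B B)
    (hDU : FundPair.IsFundamentalPair D U) :
    FundPair.IsFundamentalPair (FundPair.extD D) (FundPair.extU U) ∧
      (∃! ρ : SL(2, k) →* (MvPolynomial (Fin 2) B ≃ₐ[k] MvPolynomial (Fin 2) B),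
        FundPair.IsActionOf (FundPair.extD D) (FundPair.extU U) ρ) ∧
      (∀ ρ : SL(2, k) →* (MvPolynomial (Fin 2) B ≃ₐ[k] MvPolynomial (Fin 2) B),
        FundPair.IsActionOf (FundPair.extD D) (FundPair.extU U) ρ →
          Nonempty (FundPair.kerAlg D ≃ₐ[k] FundPair.invariants ρ)) ∧
      (FundPair.kerAlg D).FG := by
  refine ⟨hDU.ext, hDU.ext.existsUnique_action, fun ρ hρ => ?_, hDU.fg_kerAlg⟩
  rw [hDU.ext.invariants_eq_pairInvariants hρ]
  exact ⟨hDU.kerEquiv⟩
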